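/- Let $T=(V,E)$ be a finite tree with positive edge lengths $l(e)$, and equip $V$ with the path length metric $d$ ($d(x,y)$ is the total length of the path from $x$ to $y$), so that $(V,d)$ is a finite tree metric space. Let $V$ be totally ordered compatibly with $T$: for some root vertex $r\in V$, one has $u\le w$ whenever $u$ lies on the path in $T$ from $r$ to $w$. For $t\in\mathbb R$ let $\mathrm{VR}_t(V)$ be the simplicial complex of all nonempty subsets of $V$ of diameter at most $t$. Order all nonempty subsets of $V$ (the simplices of the full simplicial complex on $V$) first by diameter, then by dimension, then lexicographically with respect to the order on $V$ (comparing increasing lists of vertices). A pair $(\sigma,\tau)$ of such simplices is an *apparent pair* if $\sigma$ is the maximal facet of $\tau$ and $\tau$ is the minimal cofacet of $\sigma$ with respect to this order. Then the collection of all apparent pairs is a discrete gradient on the full simplicial complex on $V$ (the *apparent pairs gradient*): it is the collection of regular intervals of a discrete Morse function. Moreover, for all real numbers $u>t>0$ such that no edge $e\in E$ has length $l(e)\in(t,u]$, the apparent pairs gradient induces collapses $$\mathrm{VR}_u(V)\searrow \mathrm{VR}_t(V)\searrow T_t ,$$ where $T_t$ is the subforest with vertex set $V$ and all edges of $E$ of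 length at most $t$. Here a discrete gradient consisting of pairs $(\sigma,\tau)$, with $\sigma$ a facet of $\tau$, *induces a collapse* $K\searrow L$ onto a subcomplex $L\subseteq K$ if $K\setminus L$ is a union of such pairs and $L$ is obtained from $K$ by a sequence of elementary collapses, each of which removes such a pair $\{\sigma,\tau\}$, where $\tau$ is the unique proper coface of $\sigma$ in the current complex. In particular, the persistent homology of the Vietoris–Rips filtration is trivial in positive degrees: for every commutative coefficient ring $R$ and every $i>0$, the persistence module $t\mapsto H_i(\mathrm{VR}_t(V);R)$, $t\in\mathbb R$, is zero. -/

import Mathlib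

open CategoryTheory

/-! ### Simplicial complexes, collapses and discrete gradients

A simplicial complex on vertices in `V` is a `PreAbstractSimplicialComplex V`: a set of nonempty
finite subsets of `V`, closed under passing to nonempty subsets.  The top element `⊤` is the full
simplicial complex on `V`, and `K ≤ L` is inclusion of complexes. -/

/-- `σ` is a facet of `τ` (equivalently, `τ` is a cofacet of `σ`): a face of codimension one. -/
def IsFacet {V : Type*} (σ τ : Finset V) : Prop :=
  σ ⊆ τ ∧ τ.card = σ.card + 1

/-- An elementary collapse `K ↘ K \ {σ, τ} = L`: the simplex `σ` is a facet of `τ`, and `τ` is the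
unique proper coface of `σ` in `K`. -/
structure IsElementaryCollapse {V : Type*} (K L : PreAbstractSimplicialComplex V)
    (σ τ : Finset V) : Prop where
  lower_mem : σ ∈ K
  upper_mem : τ ∈ K
  isFacet : IsFacet σ τ
  unique_coface : ∀ ρ ∈ K, σ ⊂ ρ → ρ = τ
  faces_eq : L.faces = K.faces \ {σ, τ}

/-- There is a sequence of elementary collapses starting in `K` and ending in `L`, each of which
removes a pair `(σ, τ)` belonging to `W`. -/
def CollapsesAlong {V : Type*} (W : Set (Finset V × Finset V))
    (K L : PreAbstractSimplicialComplex V) : Prop :=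
  Relation.ReflTransGen (fun A B => ∃ p ∈ W, IsElementaryCollapse A B p.1 p.2) K L

/-- The set of pairs `W` induces a collapse of `K` onto the subcomplex `L`: the complement `K \ L`
is a union of pairs in `W`, and these pairs can be removed successively by elementary collapses,
starting in `K` and ending in `L`. -/
structure InducesCollapse {V : Type*} (W : Set (Finset V × Finset V))
    (K L : PreAbstractSimplicialComplex V) : Prop where
  le : L ≤ K
  union_of_pairs : ∃ P ⊆ W, K.faces \ L.faces = ⋃ p ∈ P, {p.1, p.2}
  collapses : CollapsesAlong W K L

/-- `W` is a discrete gradient on `K`.  There is a discrete Morse function `f` on `K`, that is, `f`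
is monotonic and there is a partition `P` of `K` into intervals `[I.1, I.2]` of the face poset such
that, for simplices `σ ⊆ τ`, one has `f σ = f τ` if and only if `σ` and `τ` lie in a common interval
of `P`; and `W` is the collection of the regular intervals of `P` (those with distinct endpoints).
An interval is encoded as the pair of its endpoints. -/
def IsDiscreteGradient {V : Type*} (K : PreAbstractSimplicialComplex V)
    (W : Set (Finset V × Finset V)) : Prop :=
  ∃ (f : Finset V → ℝ) (P : Set (Finset V × Finset V)),
    (∀ σ ∈ K, ∀ τ ∈ K, σ ⊆ τ → f σ ≤ f τ) ∧
    (∀ I ∈ P, I.1 ∈ K ∧ I.2 ∈ K ∧ I.1 ⊆ I.2) ∧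
    (∀ σ ∈ K, ∃! I, I ∈ P ∧ I.1 ⊆ σ ∧ σ ⊆ I.2) ∧
    (∀ σ ∈ K, ∀ τ ∈ K, σ ⊆ τ →
      (f σ = f τ ↔ ∃ I ∈ P, (I.1 ⊆ σ ∧ σ ⊆ I.2) ∧ (I.1 ⊆ τ ∧ τ ⊆ I.2))) ∧
    W = {I ∈ P | I.1 ≠ I.2}

/-! ### Apparent pairs -/

/-- The key by which simplices are compared in the `f`-lexicographic order: first by the value of
`f`, then by dimension (equivalently, by cardinality), then lexicographically, by the increasing
list of vertices. -/
noncomputable def lexKey {V : Type*} [LinearOrder V] (f : Finset V → ℝ) (σ : Finset V) :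
    ℝ ×ₗ (ℕ ×ₗ List V) :=
  toLex (f σ, toLex (σ.card, σ.sort (· ≤ ·)))

/-- `(σ, τ)` is an apparent pair of `K` for the `f`-lexicographic order: `σ` is the maximal facet
of `τ`, and `τ` is the minimal cofacet of `σ`. -/
structure IsApparentPair {V : Type*} [LinearOrder V] (K : PreAbstractSimplicialComplex V)
    (f : Finset V → ℝ) (σ τ : Finset V) : Prop where
  lower_mem : σ ∈ K
  upper_mem : τ ∈ K
  isFacet : IsFacet σ τ
  maximal_facet : ∀ ρ ∈ K, IsFacet ρ τ → lexKey f ρ ≤ lexKey f σ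
  minimal_cofacet : ∀ ρ ∈ K, IsFacet σ ρ → lexKey f τ ≤ lexKey f ρ

/-- The diameter of a simplex. -/
noncomputable def simplexDiam {V : Type*} [MetricSpace V] (σ : Finset V) : ℝ :=
  Metric.diam (σ : Set V)

/-- The apparent pairs gradient of the lexicographically refined Vietoris–Rips filtration: all
apparent pairs of the full simplicial complex on `V` for the diameter-lexicographic order. -/
def apparentPairsGradient (V : Type*) [MetricSpace V] [LinearOrder V] :
    Set (Finset V × Finset V) :=
  {p | IsApparentPair ⊤ simplexDiam p.1 p.2}

/-! ### Vietoris–Rips complexes and tree metrics -/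

/-- The Vietoris–Rips complex: nonempty finite subsets of diameter at most `t`. -/
noncomputable def vietorisRips (V : Type*) [MetricSpace V] (t : ℝ) :
    PreAbstractSimplicialComplex V where
  faces := {σ | σ.Nonempty ∧ Metric.diam (σ : Set V) ≤ t}
  isRelLowerSet_faces := fun _ hσ => ⟨hσ.1, fun _ hρ hne =>
    ⟨hne, (Metric.diam_mono (Finset.coe_subset.2 hρ)
      (Finset.finite_toSet _).isBounded).trans hσ.2⟩⟩

theorem vietorisRips_mono (V : Type*) [MetricSpace V] : Monotone (vietorisRips V) :=
  fun _ _ hst _ hσ => ⟨hσ.1, hσ.2.trans hst⟩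

/-- The subforest of all vertices of `G` and all edges of length at most `t`, as a simplicial
complex. -/
def subforest {V : Type*} (G : SimpleGraph V) (len : Sym2 V → ℝ) (t : ℝ) :
    PreAbstractSimplicialComplex V where
  faces := {σ | (∃ v, (σ : Set V) = {v}) ∨
    ∃ x y, G.Adj x y ∧ len s(x, y) ≤ t ∧ (σ : Set V) = {x, y}}
  isRelLowerSet_faces := by
    rintro σ hσ
    refine ⟨?_, ?_⟩
    · rw [← Finset.coe_nonempty]
      rcases hσ with ⟨v, h⟩ | ⟨x, y, -, -, h⟩ <;> rw [h] <;> simp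
    · rintro ρ hρ hne
      have hρ' : (ρ : Set V) ⊆ σ := Finset.coe_subset.2 hρ
      have hne' : (ρ : Set V).Nonempty := Finset.coe_nonempty.2 hne
      rcases hσ with ⟨v, h⟩ | ⟨x, y, hxy, hl, h⟩
      · rw [h] at hρ'
        exact Or.inl ⟨v, (Set.subset_singleton_iff_eq.1 hρ').resolve_left hne'.ne_empty⟩
      · rw [h] at hρ'
        rcases Set.subset_pair_iff_eq.1 hρ' with h0 | h1 | h2 | h3
        · exact absurd h0 hne'.ne_empty
        · exact Or.inl ⟨x, h1⟩
        · exact Or.inl ⟨y, h2⟩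
        · exact Or.inr ⟨x, y, hxy, hl, h3⟩

/-- The total length of a walk. -/
def walkLength {V : Type*} {G : SimpleGraph V} (len : Sym2 V → ℝ) {x y : V}
    (p : G.Walk x y) : ℝ :=
  (p.edges.map len).sum

/-- The path length metric: the infimum of the lengths of the paths from `x` to `y`. -/
noncomputable def pathDist {V : Type*} (G : SimpleGraph V) (len : Sym2 V → ℝ) (x y : V) : ℝ :=
  ⨅ p : G.Path x y, walkLength len (p : G.Walk x y)

/-- The metric space `V` is the tree metric space of the tree `G` with edge lengths `len`
(only the values of `len` on edges of `G` matter). -/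
structure IsTreeMetric {V : Type*} [MetricSpace V] (G : SimpleGraph V) (len : Sym2 V → ℝ) :
    Prop where
  isTree : G.IsTree
  len_pos : ∀ e ∈ G.edgeSet, 0 < len e
  dist_eq : ∀ x y, dist x y = pathDist G len x y

/-- The tree partial order of the tree `G` with root `r`: `u` is below `w` if `u` lies on the path
from the root `r` to `w`. -/
def RootedTreeLE {V : Type*} (G : SimpleGraph V) (r u w : V) : Prop :=
  ∃ p : G.Path r w, u ∈ (p : G.Walk r w).support

/-- The total order of `V` is compatible with the tree `G`: it extends the tree partial order for
some choice of root. -/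
def IsTreeCompatible {V : Type*} [LinearOrder V] (G : SimpleGraph V) : Prop :=
  ∃ r : V, ∀ u w : V, RootedTreeLE G r u w → u ≤ w

/-! ### Simplicial homology and persistent homology -/

/-- The `n`-dimensional simplices of `K`. -/
abbrev SimplexOfDim {V : Type*} (K : PreAbstractSimplicialComplex V) (n : ℕ) : Type _ :=
  {σ : Finset V // σ ∈ K ∧ σ.card = n + 1}

/-- The facet of `σ` opposite to the vertex `v`. -/
def SimplexOfDim.face {V : Type*} [DecidableEq V] {K : PreAbstractSimplicialComplex V} {n : ℕ}
    (σ : SimplexOfDim K (n + 1)) (v : {v // v ∈ σ.1}) : SimplexOfDim K n :=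
  ⟨σ.1.erase v.1, by
    have hc : (σ.1.erase v.1).card = n + 1 := by
      rw [Finset.card_erase_of_mem v.2, σ.2.2]; rfl
    refine ⟨(K.isRelLowerSet_faces σ.2.1).2 (Finset.erase_subset _ _) ?_, hc⟩
    rw [← Finset.card_pos, hc]
    exact Nat.succ_pos n⟩

/-- The sign of the facet `σ \ {v}` in the boundary of `σ`: it is `(-1) ^ i` when `v` is the `i`-th
vertex of `σ` (counted from `0`) in increasing order. -/
def faceSign (R : Type*) [CommRing R] {V : Type*} [LinearOrder V] (σ : Finset V) (v : V) : R :=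
  (-1) ^ (σ.filter (· < v)).card

/-- The simplicial boundary map `C_{n+1}(K; R) → C_n(K; R)`, where `C_n(K; R)` is the free
`R`-module on the `n`-simplices of `K`, oriented by the order of the vertices. -/
noncomputable def simplicialBoundary (R : Type*) [CommRing R] {V : Type*} [LinearOrder V]
    (K : PreAbstractSimplicialComplex V) (n : ℕ) :
    (SimplexOfDim K (n + 1) →₀ R) →ₗ[R] (SimplexOfDim K n →₀ R) :=
  Finsupp.linearCombination R fun σ => ∑ v : {v // v ∈ σ.1},
    Finsupp.single (σ.face v) (faceSign R σ.1 v.1)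

theorem faceSign_cancel (R : Type*) [CommRing R] {V : Type*} [LinearOrder V] (σ : Finset V)
    {v w : V} (hv : v ∈ σ) (hvw : v < w) :
    faceSign R σ v * faceSign R (σ.erase v) w + faceSign R σ w * faceSign R (σ.erase w) v = 0 := by
  have h1 : ((σ.erase w).filter (· < v)) = σ.filter (· < v) := by
    ext x; simp only [Finset.mem_filter, Finset.mem_erase]; grind
  have h2 : ((σ.erase v).filter (· < w)) = (σ.filter (· < w)).erase v := by
    ext x; simp only [Finset.mem_filter, Finset.mem_erase]; grind
  have h3 : ((σ.filter (· < w)).erase v).card + 1 = (σ.filter (· < w)).card :=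
    Finset.card_erase_add_one (by simp [hv, hvw])
  unfold faceSign
  rw [h1, h2, ← h3, pow_succ]
  ring

theorem simplicialBoundary_single (R : Type*) [CommRing R] {V : Type*} [LinearOrder V]
    (K : PreAbstractSimplicialComplex V) (n : ℕ) (σ : SimplexOfDim K (n + 1)) (a : R) :
    simplicialBoundary R K n (Finsupp.single σ a) =
      a • ∑ v : {v // v ∈ σ.1}, Finsupp.single (σ.face v) (faceSign R σ.1 v.1) := by
  simp [simplicialBoundary]

theorem simplicialBoundary_comp (R : Type*) [CommRing R] {V : Type*} [LinearOrder V]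
    (K : PreAbstractSimplicialComplex V) (n : ℕ) :
    simplicialBoundary R K n ∘ₗ simplicialBoundary R K (n + 1) = 0 := by
  refine Finsupp.lhom_ext fun σ a => ?_
  rw [LinearMap.comp_apply, simplicialBoundary_single, map_smul, map_sum, LinearMap.zero_apply]
  simp only [simplicialBoundary_single, Finset.smul_sum, Finsupp.smul_single, smul_eq_mul]
  rw [Finset.sum_sigma']
  refine Finset.sum_involution (fun p _ =>
    ⟨⟨p.2.1, Finset.mem_of_mem_erase p.2.2⟩,
      ⟨p.1.1, Finset.mem_erase.2 ⟨(Finset.ne_of_mem_erase p.2.2).symm, p.1.2⟩⟩⟩) ?_ ?_ ?_ ?_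
  · rintro ⟨⟨v, hv⟩, ⟨w, hw⟩⟩ -
    have hwv : w ≠ v := Finset.ne_of_mem_erase hw
    have hwσ : w ∈ σ.1 := Finset.mem_of_mem_erase hw
    have hface : (σ.face ⟨v, hv⟩).face ⟨w, hw⟩ =
        (σ.face ⟨w, hwσ⟩).face ⟨v, Finset.mem_erase.2 ⟨hwv.symm, hv⟩⟩ :=
      Subtype.ext Finset.erase_right_comm
    have hs : faceSign R σ.1 v * faceSign R (σ.1.erase v) w +
        faceSign R σ.1 w * faceSign R (σ.1.erase w) v = 0 := by
      rcases lt_or_gt_of_ne hwv with h | h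
      · rw [add_comm]; exact faceSign_cancel R σ.1 hwσ h
      · exact faceSign_cancel R σ.1 hv h
    dsimp only
    rw [hface, ← Finsupp.single_add]
    refine (congrArg (Finsupp.single _) ?_).trans (Finsupp.single_zero _)
    have : a * (faceSign R σ.1 v * faceSign R (σ.1.erase v) w) +
        a * (faceSign R σ.1 w * faceSign R (σ.1.erase w) v) = 0 := by
      rw [← mul_add, hs, mul_zero]
    exact this
  · rintro ⟨⟨v, hv⟩, ⟨w, hw⟩⟩ - - h
    exact Finset.ne_of_mem_erase hw (congrArg (fun p => p.1.1) h)
  · intros; simp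
  · intros; rfl

/-- The simplicial chain complex of `K` with coefficients in `R`. -/
noncomputable def simplicialChainComplex (R : Type*) [CommRing R] {V : Type*} [LinearOrder V]
    (K : PreAbstractSimplicialComplex V) : ChainComplex (ModuleCat R) ℕ :=
  ChainComplex.of (fun n => ModuleCat.of R (SimplexOfDim K n →₀ R))
    (fun n => ModuleCat.ofHom (simplicialBoundary R K n))
    (fun n => by
      rw [← ModuleCat.ofHom_comp, simplicialBoundary_comp]; rfl)

/-- The inclusion of the `n`-simplices of a subcomplex. -/
def SimplexOfDim.incl {V : Type*} {K L : PreAbstractSimplicialComplex V} (h : K ≤ L) (n : ℕ)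
    (σ : SimplexOfDim K n) : SimplexOfDim L n :=
  ⟨σ.1, h σ.2.1, σ.2.2⟩

theorem simplicialBoundary_natural (R : Type*) [CommRing R] {V : Type*} [LinearOrder V]
    {K L : PreAbstractSimplicialComplex V} (h : K ≤ L) (n : ℕ) :
    simplicialBoundary R L n ∘ₗ Finsupp.lmapDomain R R (SimplexOfDim.incl h (n + 1)) =
      Finsupp.lmapDomain R R (SimplexOfDim.incl h n) ∘ₗ simplicialBoundary R K n := by
  refine Finsupp.lhom_ext fun σ a => ?_
  simp only [LinearMap.comp_apply, Finsupp.lmapDomain_apply, Finsupp.mapDomain_single,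
    simplicialBoundary_single, Finsupp.mapDomain_smul, Finsupp.mapDomain_finsetSum]
  rfl

/-- The chain map induced by the inclusion of a subcomplex. -/
noncomputable def simplicialChainMap (R : Type*) [CommRing R] {V : Type*} [LinearOrder V]
    {K L : PreAbstractSimplicialComplex V} (h : K ≤ L) :
    simplicialChainComplex R K ⟶ simplicialChainComplex R L :=
  ChainComplex.ofHom
    (fun n => ModuleCat.ofHom (Finsupp.lmapDomain R R (SimplexOfDim.incl h n)))
    (fun n => by
      dsimp only [simplicialChainComplex]
      rw [ChainComplex.of_d, ChainComplex.of_d, ← ModuleCat.ofHom_comp, ← ModuleCat.ofHom_comp,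
        simplicialBoundary_natural])

/-- The simplicial chain complex as a functor on simplicial complexes and inclusions. -/
noncomputable def simplicialChainFunctor (R : Type*) [CommRing R] (V : Type*) [LinearOrder V] :
    PreAbstractSimplicialComplex V ⥤ ChainComplex (ModuleCat R) ℕ where
  obj K := simplicialChainComplex R K
  map f := simplicialChainMap R (leOfHom f)
  map_id K := by
    refine HomologicalComplex.hom_ext _ _ fun n => ?_
    exact congrArg ModuleCat.ofHom (Finsupp.lmapDomain_id (α := SimplexOfDim K n) R R)
  map_comp f g := by
    refine HomologicalComplex.hom_ext _ _ fun n => ?_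
    exact congrArg ModuleCat.ofHom (Finsupp.lmapDomain_comp R R
      (SimplexOfDim.incl (leOfHom f) n) (SimplexOfDim.incl (leOfHom g) n))

/-- The persistent homology in degree `i` of the Vietoris–Rips filtration of `V`, with coefficients
in `R`: the persistence module `t ↦ H_i(VR_t(V); R)` with the maps induced by inclusions. -/
noncomputable def vietorisRipsPersistentHomology (R : Type*) [CommRing R] (V : Type*)
    [MetricSpace V] [LinearOrder V] (i : ℕ) : ℝ ⥤ ModuleCat R :=
  (vietorisRips_mono V).functor ⋙ simplicialChainFunctor R V ⋙
    HomologicalComplex.homologyFunctor (ModuleCat R) (ComplexShape.down ℕ) i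

/-! ### The lexicographic order on simplices -/

/-! That apparent pairs form a gradient and permit collapses is formal and holds for any monotone
`f`. Pairs are disjoint, and the upper simplex of a pair precedes every other proper coface of the
lower one. Hence rank, with each lower simplex raised to the rank of its partner, is a discrete
Morse function, and pairs can be removed from the largest simplex down.

The geometric core is `exists_isApparentPair`: a simplex `ρ` that is neither a vertex nor an edge of
the tree lies in an apparent pair of simplices of its own diameter `D`, neither being a vertex or an
edge. Let `B` be the set of vertices within `D` of all of `ρ`. The four-point inequality `d(v,w) +
d(x,y) ≤ max (d(v,x) + d(w,y)) (d(v,y) + d(w,x))` shows that `B` has diameter `D`, that it is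
convex, and that a point strictly inside a geodesic of `B` is at distance less than `D` from all of
`B`. The pair is found by toggling one vertex of `ρ`: the minimum `a` of `B` if `ρ` without `a`
still has diameter `D`, and otherwise the minimum `b` of the rest of `B`. In the second case,
convexity and compatibility of the order with the root force `b` to lie strictly between `a` and
some other point of `B`, so toggling `b` cannot affect the diameter.

Since the two simplices of a pair have equal diameter, they enter the filtration together, which
gives both collapses. An elementary collapse does not create cycles that fail to bound
(`CyclesBound.of_isElementaryCollapse`), and a forest has no nonzero cycle of positive degree, so
positive-degree homology vanishes. -/

theorem lexKey_injective {V : Type*} [LinearOrder V] (f : Finset V → ℝ) :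
    Function.Injective (lexKey f) := by
  intro σ τ h
  have h1 := congrArg (fun x => (ofLex (ofLex x).2).2) h
  have h2 : σ.sort (· ≤ ·) = τ.sort (· ≤ ·) := h1
  rw [← Finset.sort_toFinset (s := σ) (r := (· ≤ ·)), h2, Finset.sort_toFinset]

theorem lexKey_lt_of_ssubset {V : Type*} [LinearOrder V] {f : Finset V → ℝ} (hf : Monotone f)
    {σ τ : Finset V} (h : σ ⊂ τ) : lexKey f σ < lexKey f τ := by
  unfold lexKey
  rw [Prod.Lex.toLex_lt_toLex]
  rcases (hf h.subset).lt_or_eq with h1 | h1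
  · exact Or.inl h1
  · exact Or.inr ⟨h1, Prod.Lex.toLex_lt_toLex.2 (Or.inl (Finset.card_lt_card h))⟩

theorem lexKey_le_of_subset {V : Type*} [LinearOrder V] {f : Finset V → ℝ} (hf : Monotone f)
    {σ τ : Finset V} (h : σ ⊆ τ) : lexKey f σ ≤ lexKey f τ := by
  rcases h.eq_or_ssubset with rfl | h
  · exact le_rfl
  · exact (lexKey_lt_of_ssubset hf h).le

/-- Here `v` is the least element of the symmetric difference. The length bound excludes the case
where `l'` is a proper prefix of `l` and therefore smaller. -/
theorem list_lt_of_min_symmDiff {V : Type*} [LinearOrder V] {v : V} :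
    ∀ {l l' : List V}, l.SortedLT → l'.SortedLT → v ∈ l → v ∉ l' →
      (∀ x < v, x ∈ l ↔ x ∈ l') → l.length ≤ l'.length → l < l'
  | [], _, _, _, h, _, _, _ => by simp at h
  | _ :: _, [], _, _, _, _, _, h => by simp at h
  | a :: l, b :: l', hl, hl', hv, hv', h, hlen => by
    rw [List.cons_lt_cons_iff]
    rw [List.sortedLT_iff_pairwise, List.pairwise_cons] at hl hl'
    rcases lt_trichotomy a b with hab | rfl | hab
    · exact Or.inl hab
    · refine Or.inr ⟨rfl, ?_⟩
      simp only [List.mem_cons, not_or] at hv hv'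
      refine list_lt_of_min_symmDiff (List.sortedLT_iff_pairwise.2 hl.2)
        (List.sortedLT_iff_pairwise.2 hl'.2) (hv.resolve_left hv'.1) hv'.2 ?_
        (by simpa using hlen)
      intro x hx
      have := h x hx
      simp only [List.mem_cons] at this
      constructor
      · intro hxl
        exact (this.1 (Or.inr hxl)).resolve_left (hl.1 x hxl).ne'
      · intro hxl
        exact (this.2 (Or.inr hxl)).resolve_left (hl'.1 x hxl).ne'
    · exfalso
      have hav : a ≤ v := by
        rcases List.mem_cons.1 hv with rfl | hv
        · exact le_rfl
        · exact (hl.1 v hv).le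
      have hb := (h b (hab.trans_le hav)).2 (by simp)
      rcases List.mem_cons.1 hb with rfl | hb
      · exact lt_irrefl _ hab
      · exact lt_asymm hab (hl.1 b hb)

theorem sort_lt_sort_of_min_symmDiff {V : Type*} [LinearOrder V] {σ τ : Finset V} {v : V}
    (hσ : v ∈ σ) (hτ : v ∉ τ) (h : ∀ x < v, x ∈ σ ↔ x ∈ τ) (hc : σ.card ≤ τ.card) :
    σ.sort (· ≤ ·) < τ.sort (· ≤ ·) :=
  list_lt_of_min_symmDiff (v := v) σ.sortedLT_sort τ.sortedLT_sort (by simpa using hσ)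
    (by simpa using hτ) (by simpa using h) (by simpa using hc)

theorem lexKey_lt_of_min_symmDiff {V : Type*} [LinearOrder V] {f : Finset V → ℝ}
    {σ τ : Finset V} {v : V} (hf : f σ = f τ) (hc : σ.card = τ.card)
    (hσ : v ∈ σ) (hτ : v ∉ τ) (h : ∀ x < v, x ∈ σ ↔ x ∈ τ) : lexKey f σ < lexKey f τ :=
  Prod.Lex.toLex_lt_toLex.2 (Or.inr ⟨hf, Prod.Lex.toLex_lt_toLex.2
    (Or.inr ⟨hc, sort_lt_sort_of_min_symmDiff hσ hτ h hc.le⟩)⟩)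

theorem lexKey_lt_of_lt {V : Type*} [LinearOrder V] {f : Finset V → ℝ} {σ τ : Finset V}
    (h : f σ < f τ) : lexKey f σ < lexKey f τ :=
  Prod.Lex.toLex_lt_toLex.2 (Or.inl h)

/-! ### Facets -/

theorem IsFacet.ssubset {V : Type*} {σ τ : Finset V} (h : IsFacet σ τ) : σ ⊂ τ := by
  refine h.1.ssubset_of_ne ?_
  rintro rfl
  exact absurd h.2 (by omega)

theorem isFacet_insert {V : Type*} [DecidableEq V] {σ : Finset V} {v : V} (hv : v ∉ σ) :
    IsFacet σ (insert v σ) :=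
  ⟨Finset.subset_insert _ _, Finset.card_insert_of_notMem hv⟩

theorem IsFacet.exists_insert {V : Type*} [DecidableEq V] {σ τ : Finset V} (h : IsFacet σ τ) :
    ∃ v, v ∉ σ ∧ insert v σ = τ := by
  obtain ⟨v, hv, hσ⟩ := Finset.exists_of_ssubset h.ssubset
  refine ⟨v, hσ, Finset.eq_of_subset_of_card_le (Finset.insert_subset hv h.1) ?_⟩
  rw [Finset.card_insert_of_notMem hσ, h.2]

theorem IsFacet.eq_or_eq {V : Type*} {σ τ ρ : Finset V} (h : IsFacet σ τ) (h1 : σ ⊆ ρ)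
    (h2 : ρ ⊆ τ) : ρ = σ ∨ ρ = τ := by
  have c1 := Finset.card_le_card h1
  have c2 := Finset.card_le_card h2
  have c3 := h.2
  rcases Nat.lt_or_ge σ.card ρ.card with h3 | h3
  · exact Or.inr (Finset.eq_of_subset_of_card_le h2 (by omega))
  · exact Or.inl (Finset.eq_of_subset_of_card_le h1 h3).symm

theorem PreAbstractSimplicialComplex.mem_of_subset {V : Type*}
    {K : PreAbstractSimplicialComplex V} {σ τ : Finset V} (hτ : τ ∈ K) (h : σ ⊆ τ)
    (hσ : σ.Nonempty) : σ ∈ K :=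
  (K.isRelLowerSet_faces hτ).2 h hσ

theorem PreAbstractSimplicialComplex.nonempty {V : Type*}
    {K : PreAbstractSimplicialComplex V} {τ : Finset V} (hτ : τ ∈ K) : τ.Nonempty :=
  (K.isRelLowerSet_faces hτ).1

/-! ### Apparent pairs form a discrete gradient -/

namespace IsApparentPair

variable {V : Type*} [LinearOrder V] {K : PreAbstractSimplicialComplex V} {f : Finset V → ℝ}
  {σ τ ρ : Finset V}

/-- The upper simplex of an apparent pair precedes every other proper coface of the lower one. -/
theorem lexKey_upper_lt (hf : Monotone f) (h : IsApparentPair K f σ τ) (hρ : ρ ∈ K)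
    (hσρ : σ ⊂ ρ) (hne : ρ ≠ τ) : lexKey f τ < lexKey f ρ := by
  obtain ⟨v, hv, hvσ⟩ := Finset.exists_of_ssubset hσρ
  have hsub : insert v σ ⊆ ρ := Finset.insert_subset hv hσρ.subset
  have h1 := h.minimal_cofacet (insert v σ)
    (K.mem_of_subset hρ hsub (Finset.insert_nonempty _ _)) (isFacet_insert hvσ)
  refine lt_of_le_of_ne (h1.trans (lexKey_le_of_subset hf hsub)) fun he => ?_
  exact hne (lexKey_injective f he).symm

theorem upper_unique (h : IsApparentPair K f σ τ) (h' : IsApparentPair K f σ ρ) : τ = ρ :=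
  lexKey_injective f (le_antisymm (h.minimal_cofacet _ h'.upper_mem h'.isFacet)
    (h'.minimal_cofacet _ h.upper_mem h.isFacet))

theorem lower_unique (h : IsApparentPair K f σ τ) (h' : IsApparentPair K f ρ τ) : σ = ρ :=
  lexKey_injective f (le_antisymm (h'.maximal_facet _ h.lower_mem h.isFacet)
    (h.maximal_facet _ h'.lower_mem h'.isFacet))

/-- Between `σ` and `ρ = σ ∪ {v, w}` lie exactly `τ = σ ∪ {v}` and `σ ∪ {w}`. The second is a
cofacet of `σ`, so it is at least `τ`, and a facet of `ρ`, so it is at most `τ`; but the two differ.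
-/
theorem not_comp (h : IsApparentPair K f σ τ) (h' : IsApparentPair K f τ ρ) : False := by
  obtain ⟨v, hv, rfl⟩ := h.isFacet.exists_insert
  obtain ⟨w, hw, rfl⟩ := h'.isFacet.exists_insert
  rw [Finset.mem_insert, not_or] at hw
  have hmem : insert w σ ∈ K := K.mem_of_subset h'.upper_mem
    (Finset.insert_subset_insert _ (Finset.subset_insert _ _)) (Finset.insert_nonempty _ _)
  have h1 := h.minimal_cofacet _ hmem (isFacet_insert hw.2)
  have h2 := h'.maximal_facet (insert w σ) hmem (by
    rw [Finset.insert_comm]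
    exact isFacet_insert (by simp [Ne.symm hw.1, hv]))
  have := lexKey_injective f (le_antisymm h1 h2)
  have hv' : v ∈ insert w σ := this ▸ Finset.mem_insert_self v σ
  rcases Finset.mem_insert.1 hv' with h3 | h3
  · exact hw.1 h3.symm
  · exact hv h3

end IsApparentPair

/-- The apparent pairs form a discrete gradient. -/
theorem isDiscreteGradient_apparentPairs {V : Type*} [Fintype V] [LinearOrder V]
    (K : PreAbstractSimplicialComplex V) {f : Finset V → ℝ} (hf : Monotone f) :
    IsDiscreteGradient K {p | IsApparentPair K f p.1 p.2} := by
  classical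
  -- The rank of a simplex turns the order into a real-valued function.
  set r : Finset V → ℝ := fun σ =>
    ((Finset.univ.filter fun ρ => lexKey f ρ < lexKey f σ).card : ℝ) with hr
  have hr_lt : ∀ σ τ, lexKey f σ < lexKey f τ → r σ < r τ := by
    intro σ τ h
    refine Nat.cast_lt.2 (Finset.card_lt_card ?_)
    refine ⟨fun ρ hρ => ?_, fun hsub => ?_⟩
    · simp only [Finset.mem_filter, Finset.mem_univ, true_and] at hρ ⊢
      exact hρ.trans h
    · have := hsub (x := σ) (by simpa using h)
      simp at this
  -- Lower simplices take the rank of their partner. This stays below the rank of every other proper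
  -- coface, so `g` is constant on pairs and strictly increasing elsewhere.
  let g : Finset V → ℝ := fun σ =>
    if h : ∃ τ, IsApparentPair K f σ τ then r h.choose else r σ
  have g_lower : ∀ σ τ, IsApparentPair K f σ τ → g σ = r τ := by
    intro σ τ h
    have hex : ∃ τ, IsApparentPair K f σ τ := ⟨τ, h⟩
    simp only [g, dif_pos hex]
    rw [h.upper_unique hex.choose_spec]
  have g_other : ∀ σ, (¬ ∃ τ, IsApparentPair K f σ τ) → g σ = r σ := fun σ h => dif_neg h
  have g_ge : ∀ σ, r σ ≤ g σ := by
    intro σ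
    by_cases h : ∃ τ, IsApparentPair K f σ τ
    · obtain ⟨τ, h⟩ := h
      rw [g_lower σ τ h]
      exact (hr_lt _ _ (lexKey_lt_of_ssubset hf h.isFacet.ssubset)).le
    · rw [g_other σ h]
  have g_lt : ∀ σ τ, τ ∈ K → σ ⊂ τ → ¬ IsApparentPair K f σ τ → g σ < g τ := by
    intro σ τ hτ hsub hn
    by_cases h : ∃ ρ, IsApparentPair K f σ ρ
    · obtain ⟨ρ, h⟩ := h
      rw [g_lower σ ρ h]
      refine (hr_lt _ _ (h.lexKey_upper_lt hf hτ hsub ?_)).trans_le (g_ge τ)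
      rintro rfl
      exact hn h
    · rw [g_other σ h]
      exact (hr_lt _ _ (lexKey_lt_of_ssubset hf hsub)).trans_le (g_ge τ)
  have g_eq : ∀ σ τ, IsApparentPair K f σ τ → g σ = g τ := by
    intro σ τ h
    rw [g_lower σ τ h, g_other τ]
    rintro ⟨ρ, h'⟩
    exact h.not_comp h'
  -- Unpaired simplices form the singleton intervals; they are critical.
  let P : Set (Finset V × Finset V) := {I | IsApparentPair K f I.1 I.2 ∨
    (I.1 = I.2 ∧ I.1 ∈ K ∧ ∀ ρ, ¬ IsApparentPair K f I.1 ρ ∧ ¬ IsApparentPair K f ρ I.1)}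
  have P_cover : ∀ σ ∈ K, ∃ I ∈ P, I.1 ⊆ σ ∧ σ ⊆ I.2 := by
    intro σ hσ
    by_cases h1 : ∃ ρ, IsApparentPair K f σ ρ
    · obtain ⟨ρ, h⟩ := h1
      exact ⟨(σ, ρ), Or.inl h, subset_rfl, h.isFacet.1⟩
    by_cases h2 : ∃ ρ, IsApparentPair K f ρ σ
    · obtain ⟨ρ, h⟩ := h2
      exact ⟨(ρ, σ), Or.inl h, h.isFacet.1, subset_rfl⟩
    · push Not at h1 h2
      exact ⟨(σ, σ), Or.inr ⟨rfl, hσ, fun ρ => ⟨h1 ρ, h2 ρ⟩⟩, subset_rfl, subset_rfl⟩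
  have P_mem : ∀ I ∈ P, ∀ σ, I.1 ⊆ σ → σ ⊆ I.2 → σ = I.1 ∨ σ = I.2 := by
    rintro I (h | ⟨h, -, -⟩) σ h1 h2
    · exact h.isFacet.eq_or_eq h1 h2
    · exact Or.inl (subset_antisymm (h2.trans h.symm.subset) h1)
  refine ⟨g, P, ?_, ?_, ?_, ?_, ?_⟩
  · intro σ _ τ hτ hsub
    rcases hsub.eq_or_ssubset with rfl | hss
    · exact le_rfl
    by_cases h : IsApparentPair K f σ τ
    · exact (g_eq σ τ h).le
    · exact (g_lt σ τ hτ hss h).le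
  · rintro I (h | ⟨h, h1, -⟩)
    · exact ⟨h.lower_mem, h.upper_mem, h.isFacet.1⟩
    · exact ⟨h1, h ▸ h1, h.subset⟩
  · intro σ hσ
    obtain ⟨I, hI, h1, h2⟩ := P_cover σ hσ
    refine ⟨I, ⟨hI, h1, h2⟩, ?_⟩
    rintro J ⟨hJ, h3, h4⟩
    have hI' := P_mem I hI σ h1 h2
    have hJ' := P_mem J hJ σ h3 h4
    obtain ⟨I1, I2⟩ := I
    obtain ⟨J1, J2⟩ := J
    simp only at hI' hJ' h1 h2 h3 h4
    rcases hI with hI | ⟨hI, -, hIc⟩ <;> rcases hJ with hJ | ⟨hJ, -, hJc⟩ <;>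
      simp only at hI hJ
    · rcases hI' with rfl | rfl <;> rcases hJ' with rfl | rfl
      · rw [hI.upper_unique hJ]
      · exact (hJ.not_comp hI).elim
      · exact (hI.not_comp hJ).elim
      · rw [hI.lower_unique hJ]
    · subst hJ
      simp only [or_self] at hJ'
      subst hJ'
      rcases hI' with rfl | rfl
      · exact absurd hI (hJc _).1
      · exact absurd hI (hJc _).2
    · subst hI
      simp only [or_self] at hI'
      subst hI'
      rcases hJ' with rfl | rfl
      · exact absurd hJ (hIc _).1
      · exact absurd hJ (hIc _).2
    · subst hI hJ
      simp only [or_self] at hI' hJ'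
      rw [← hI', ← hJ']
  · intro σ hσ τ hτ hsub
    constructor
    · intro he
      rcases hsub.eq_or_ssubset with rfl | hss
      · obtain ⟨I, hI, h⟩ := P_cover σ hσ
        exact ⟨I, hI, h, h⟩
      · by_cases h : IsApparentPair K f σ τ
        · exact ⟨(σ, τ), Or.inl h, ⟨subset_rfl, hsub⟩, hsub, subset_rfl⟩
        · exact absurd he (g_lt σ τ hτ hss h).ne
    · rintro ⟨I, hI, ⟨h1, h2⟩, h3, h4⟩
      have g12 : g I.1 = g I.2 := by
        rcases hI with hI | ⟨hI, -⟩
        · exact g_eq _ _ hI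
        · rw [hI]
      rcases P_mem I hI σ h1 h2 with h | h <;> rcases P_mem I hI τ h3 h4 with h' | h' <;>
        rw [h, h'] <;> first | exact g12 | exact g12.symm
  · ext I
    constructor
    · intro h
      exact ⟨Or.inl h, h.isFacet.ssubset.ne⟩
    · rintro ⟨h | h, hne⟩
      · exact h
      · exact absurd h.1 hne

/-! ### Collapses along apparent pairs -/

/-- The complex obtained by removing a simplex `σ` and its only proper coface `τ`. -/
def PreAbstractSimplicialComplex.removePair {V : Type*} (K : PreAbstractSimplicialComplex V)
    (σ τ : Finset V) (hστ : σ ⊆ τ) (h : ∀ ρ ∈ K, σ ⊂ ρ → ρ = τ) (hτ : ∀ ρ ∈ K, ¬ τ ⊂ ρ) :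
    PreAbstractSimplicialComplex V where
  faces := K.faces \ {σ, τ}
  isRelLowerSet_faces := by
    rintro ρ ⟨hρ, hρ'⟩
    simp only [Set.mem_insert_iff, Set.mem_singleton_iff, not_or] at hρ'
    refine ⟨K.nonempty hρ, fun π hπ hne => ⟨K.mem_of_subset hρ hπ hne, ?_⟩⟩
    simp only [Set.mem_insert_iff, Set.mem_singleton_iff, not_or]
    have key : π ≠ τ := by
      rintro rfl
      exact hτ ρ hρ (hπ.ssubset_of_ne (Ne.symm hρ'.2))
    refine ⟨?_, key⟩
    rintro rfl
    exact hρ'.2 (h ρ hρ (hπ.ssubset_of_ne (Ne.symm hρ'.1)))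

/-- The largest simplex of `K \ L` must be the upper one of its pair. Any other proper coface of its
partner `σ` in `K` would be larger still, and cannot lie in `L` because `σ` does not. So the pair is
free to collapse; since pairs are disjoint, the remaining difference is again a union of pairs. -/
theorem collapsesAlong_apparentPairs {V : Type*} [Finite V] [LinearOrder V]
    {M : PreAbstractSimplicialComplex V} {f : Finset V → ℝ} (hf : Monotone f)
    (L : PreAbstractSimplicialComplex V) (n : ℕ) :
    ∀ K : PreAbstractSimplicialComplex V, (K.faces \ L.faces).ncard = n → K ≤ M → L ≤ K →
    (∀ ρ ∈ K.faces \ L.faces, ∃ σ ∈ K.faces \ L.faces, ∃ τ ∈ K.faces \ L.faces,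
      IsApparentPair M f σ τ ∧ (ρ = σ ∨ ρ = τ)) →
    CollapsesAlong {p | IsApparentPair M f p.1 p.2} K L := by
  induction n using Nat.strong_induction_on with
  | _ n ih =>
  intro K hn hKM hLK hP
  rcases (K.faces \ L.faces).eq_empty_or_nonempty with he | hne
  · have : K = L := by
      refine le_antisymm ?_ hLK
      exact Set.sdiff_eq_empty.1 he
    subst this
    exact Relation.ReflTransGen.refl
  obtain ⟨ρ, hρ, hmax⟩ := Set.exists_max_image (K.faces \ L.faces) (lexKey f)
    (Set.toFinite _) hne
  obtain ⟨σ, hσ, τ, hτ, hp, hρ'⟩ := hP ρ hρ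
  have hlt := lexKey_lt_of_ssubset hf hp.isFacet.ssubset
  have hρτ : ρ = τ := by
    rcases hρ' with rfl | h
    · exact absurd hlt (hmax τ hτ).not_gt
    · exact h
  subst hρτ
  have hcoface : ∀ π ∈ K, σ ⊂ π → π = ρ := by
    intro π hπ hsub
    by_contra hne
    have hπL : π ∉ L.faces := fun h =>
      hσ.2 (L.mem_of_subset h hsub.subset (K.nonempty hσ.1))
    exact absurd (hp.lexKey_upper_lt hf (hKM hπ) hsub hne) (hmax π ⟨hπ, hπL⟩).not_gt
  have htop : ∀ π ∈ K, ¬ ρ ⊂ π := by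
    intro π hπ hsub
    exact hsub.ne (hcoface π hπ (hp.isFacet.ssubset.trans hsub)).symm
  let K' := K.removePair σ ρ hp.isFacet.1 hcoface htop
  have hK' : K'.faces \ L.faces = (K.faces \ L.faces) \ {σ, ρ} := by
    ext π
    simp only [K', PreAbstractSimplicialComplex.removePair, Set.mem_sdiff]
    tauto
  have hstep : IsElementaryCollapse K K' σ ρ := ⟨hσ.1, hτ.1, hp.isFacet, hcoface, rfl⟩
  refine Relation.ReflTransGen.head ⟨(σ, ρ), hp, hstep⟩ ?_
  refine ih _ ?_ K' rfl ?_ ?_ ?_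
  · rw [← hn, hK']
    refine Set.ncard_lt_ncard ⟨Set.sdiff_subset, fun h => ?_⟩ (Set.toFinite _)
    exact (h hτ).2 (by simp)
  · exact fun π hπ => hKM hπ.1
  · intro π hπ
    refine ⟨hLK hπ, ?_⟩
    rintro (rfl | rfl)
    · exact hσ.2 hπ
    · exact hτ.2 hπ
  · rw [hK']
    rintro π ⟨hπ, hπ'⟩
    obtain ⟨σ', hσ', τ', hτ', hp', hπp⟩ := hP π hπ
    simp only [Set.mem_insert_iff, Set.mem_singleton_iff, not_or] at hπ'
    have h1 : σ' ≠ σ := by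
      rintro rfl
      rcases hπp with h | h
      · exact hπ'.1 h
      · exact hπ'.2 (h.trans (hp'.upper_unique hp))
    have h2 : τ' ≠ ρ := by
      rintro rfl
      exact h1 (hp'.lower_unique hp)
    have h3 : σ' ≠ ρ := by
      rintro rfl
      exact hp.not_comp hp'
    have h4 : τ' ≠ σ := by
      rintro rfl
      exact hp'.not_comp hp
    exact ⟨σ', ⟨hσ', by simp [h1, h3]⟩, τ', ⟨hτ', by simp [h2, h4]⟩, hp', hπp⟩

theorem inducesCollapse_apparentPairs {V : Type*} [Finite V] [LinearOrder V]
    {M K L : PreAbstractSimplicialComplex V} {f : Finset V → ℝ} (hf : Monotone f)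
    (hKM : K ≤ M) (hLK : L ≤ K)
    (hP : ∀ ρ ∈ K.faces \ L.faces, ∃ σ ∈ K.faces \ L.faces, ∃ τ ∈ K.faces \ L.faces,
      IsApparentPair M f σ τ ∧ (ρ = σ ∨ ρ = τ)) :
    InducesCollapse {p | IsApparentPair M f p.1 p.2} K L := by
  refine ⟨hLK, ⟨{p | IsApparentPair M f p.1 p.2 ∧ p.1 ∈ K.faces \ L.faces ∧
    p.2 ∈ K.faces \ L.faces}, fun p hp => hp.1, ?_⟩,
    collapsesAlong_apparentPairs hf L _ K rfl hKM hLK hP⟩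
  ext ρ
  simp only [Set.mem_iUnion]
  constructor
  · intro hρ
    obtain ⟨σ, hσ, τ, hτ, hp, h⟩ := hP ρ hρ
    exact ⟨(σ, τ), ⟨hp, hσ, hτ⟩, h⟩
  · rintro ⟨p, ⟨-, h1, h2⟩, h | h⟩
    · exact h ▸ h1
    · rw [Set.mem_singleton_iff.1 h]
      exact h2

/-- A criterion for apparent pairs of equal value in the full simplicial complex. -/
theorem isApparentPair_insert {V : Type*} [LinearOrder V] {f : Finset V → ℝ} (hf : Monotone f)
    {σ : Finset V} {v : V} (hne : σ.Nonempty) (hv : v ∉ σ) (heq : f (insert v σ) = f σ)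
    (hmin : ∀ w, w ∉ σ → f (insert w σ) = f σ → v ≤ w)
    (hmax : ∀ w ∈ σ, f ((insert v σ).erase w) = f σ → v ≤ w) :
    IsApparentPair ⊤ f σ (insert v σ) where
  lower_mem := hne
  upper_mem := Finset.insert_nonempty _ _
  isFacet := isFacet_insert hv
  maximal_facet := by
    intro ρ _ hρ
    obtain ⟨w, hw, he⟩ := hρ.exists_insert
    have hwτ : w ∈ insert v σ := he ▸ Finset.mem_insert_self w ρ
    have hρe : ρ = (insert v σ).erase w := by rw [← he, Finset.erase_insert hw]
    rcases Finset.mem_insert.1 hwτ with rfl | hwσ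
    · rw [hρe, Finset.erase_insert hv]
    have hle : f ρ ≤ f σ := heq ▸ hf hρ.1
    rcases hle.lt_or_eq with hlt | hfe
    · exact (lexKey_lt_of_lt hlt).le
    have hvw : v < w := lt_of_le_of_ne (hmax w hwσ (hρe ▸ hfe)) (by rintro rfl; exact hv hwσ)
    -- `ρ` and `σ` differ only in that `ρ` contains `v` and `σ` contains `w > v`, so `ρ` comes
    -- first.
    refine (lexKey_lt_of_min_symmDiff (v := v) hfe ?_ ?_ hv ?_).le
    · have := hρ.2
      rw [Finset.card_insert_of_notMem hv] at this
      omega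
    · rw [hρe]
      simp [hvw.ne]
    · intro x hx
      rw [hρe]
      simp [hx.ne, (hx.trans hvw).ne]
  minimal_cofacet := by
    intro ρ _ hρ
    obtain ⟨w, hw, rfl⟩ := hρ.exists_insert
    rcases (hf hρ.1).lt_or_eq with hlt | hfe
    · exact (lexKey_lt_of_lt (heq ▸ hlt)).le
    rcases (hmin w hw hfe.symm).lt_or_eq with hvw | rfl
    · refine (lexKey_lt_of_min_symmDiff (v := v) (heq.trans hfe) ?_ (by simp) ?_ ?_).le
      · rw [Finset.card_insert_of_notMem hv, Finset.card_insert_of_notMem hw]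
      · simp [hvw.ne, hv]
      · intro x hx
        simp [hx.ne, (hx.trans hvw).ne]
    · exact le_rfl

/-! ### Tree metrics -/

theorem SimpleGraph.Walk.IsPath.append_of_disjoint {V : Type*} {G : SimpleGraph V} {x y z : V}
    {p : G.Walk x y} {q : G.Walk y z} (hp : p.IsPath) (hq : q.IsPath)
    (h : ∀ v ∈ p.support, v ∈ q.support → v = y) : (p.append q).IsPath := by
  rw [SimpleGraph.Walk.isPath_def, SimpleGraph.Walk.support_append, List.nodup_append]
  have hq' := hq.support_nodup
  rw [← SimpleGraph.Walk.cons_tail_support, List.nodup_cons] at hq'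
  refine ⟨hp.support_nodup, hq'.2, ?_⟩
  rintro v hv w hw rfl
  exact hq'.1 (h v hv (List.mem_of_mem_tail hw) ▸ hw)

namespace IsTreeMetric

variable {V : Type*} [MetricSpace V] {G : SimpleGraph V} {len : Sym2 V → ℝ}

theorem dist_eq_walkLength (hT : IsTreeMetric G len) {x y : V} {p : G.Walk x y}
    (hp : p.IsPath) : dist x y = walkLength len p := by
  rw [hT.dist_eq, pathDist]
  have : Nonempty (G.Path x y) := ⟨⟨p, hp⟩⟩
  have : ∀ q : G.Path x y, walkLength len (q : G.Walk x y) = walkLength len p := fun q => by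
    rw [(hT.isTree.isAcyclic.subsingleton_path x y).elim q ⟨p, hp⟩]
  simp only [this]
  exact ciInf_const

theorem exists_isPath (hT : IsTreeMetric G len) (x y : V) : ∃ p : G.Walk x y, p.IsPath :=
  (hT.isTree.existsUnique_path x y).exists

theorem dist_of_adj (hT : IsTreeMetric G len) {x y : V} (h : G.Adj x y) :
    dist x y = len s(x, y) := by
  have hp : (SimpleGraph.Walk.cons h SimpleGraph.Walk.nil).IsPath := by
    simp [SimpleGraph.Walk.cons_isPath_iff, h.ne]
  rw [hT.dist_eq_walkLength hp]
  simp [walkLength]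

theorem dist_append (hT : IsTreeMetric G len) {x y z : V} {p : G.Walk x y} {q : G.Walk y z}
    (h : (p.append q).IsPath) : dist x y + dist y z = dist x z := by
  rw [hT.dist_eq_walkLength h, hT.dist_eq_walkLength h.of_append_left,
    hT.dist_eq_walkLength h.of_append_right]
  simp [walkLength, SimpleGraph.Walk.edges_append]

theorem dist_add_of_mem_support (hT : IsTreeMetric G len) {x y m : V} {p : G.Walk x y}
    (hp : p.IsPath) (hm : m ∈ p.support) : dist x m + dist m y = dist x y := by
  classical
  exact hT.dist_append (p := p.takeUntil m hm) (q := p.dropUntil m hm) (by simpa using hp)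

/-- Take `m` to be the point of `p` nearest to `z`. The path from `z` to `m` meets `p` only in `m`,
so following it along `p` in either direction is again a path. -/
theorem exists_median_mem_support (hT : IsTreeMetric G len) {x y : V} {p : G.Walk x y}
    (hp : p.IsPath) (z : V) : ∃ m ∈ p.support,
      dist z m + dist m x = dist z x ∧ dist z m + dist m y = dist z y := by
  classical
  obtain ⟨m, hm, hmin⟩ := Finset.exists_min_image p.support.toFinset (dist z)
    ⟨x, by simp⟩
  simp only [List.mem_toFinset] at hm hmin
  obtain ⟨q, hq⟩ := hT.exists_isPath z m
  have hdisj : ∀ v ∈ q.support, v ∈ p.support → v = m := by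
    intro v hv hvp
    have h1 := hT.dist_add_of_mem_support hq hv
    have h2 := hmin v hvp
    exact dist_le_zero.1 (by linarith)
  refine ⟨m, hm, ?_, ?_⟩
  · refine hT.dist_append (p := q) (q := (p.takeUntil m hm).reverse)
      (hq.append_of_disjoint (hp.takeUntil hm).reverse fun v hv hv' => hdisj v hv ?_)
    rw [SimpleGraph.Walk.support_reverse, List.mem_reverse] at hv'
    exact p.support_takeUntil_subset_support hm hv'
  · exact hT.dist_append (p := q) (q := p.dropUntil m hm)
      (hq.append_of_disjoint (hp.dropUntil hm) fun v hv hv' =>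
        hdisj v hv (p.support_dropUntil_subset_support hm hv'))

/-- Conversely, if `n` is the projection of `m` to the path, passing through `m` costs an extra `2 *
dist m n`, which must vanish. -/
theorem mem_support_iff (hT : IsTreeMetric G len) {x y m : V} {p : G.Walk x y}
    (hp : p.IsPath) : m ∈ p.support ↔ dist x m + dist m y = dist x y := by
  refine ⟨hT.dist_add_of_mem_support hp, fun h => ?_⟩
  obtain ⟨n, hn, h1, h2⟩ := hT.exists_median_mem_support hp m
  have h3 := hT.dist_add_of_mem_support hp hn
  have h4 : dist m n = 0 := by
    rw [dist_comm x m] at h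
    rw [dist_comm x n] at h3
    linarith
  rwa [dist_eq_zero.1 h4]

/-- Any three points of a tree have a median. -/
theorem exists_median (hT : IsTreeMetric G len) (x y z : V) : ∃ m,
    dist x m + dist m y = dist x y ∧ dist z m + dist m x = dist z x ∧
      dist z m + dist m y = dist z y := by
  obtain ⟨p, hp⟩ := hT.exists_isPath x y
  obtain ⟨m, hm, h⟩ := hT.exists_median_mem_support hp z
  exact ⟨m, hT.dist_add_of_mem_support hp hm, h⟩

/-- Two points on a geodesic are linearly ordered along it. -/
theorem between_total (hT : IsTreeMetric G len) {x y m n : V}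
    (hm : dist x m + dist m y = dist x y) (hn : dist x n + dist n y = dist x y) :
    dist x n + dist n m = dist x m ∨ dist x m + dist m n = dist x n := by
  classical
  obtain ⟨p, hp⟩ := hT.exists_isPath x y
  have hmp := (hT.mem_support_iff hp).2 hm
  have hnp := (hT.mem_support_iff hp).2 hn
  rw [← p.take_spec hmp, SimpleGraph.Walk.mem_support_append_iff] at hnp
  rcases hnp with h | h
  · exact Or.inl (hT.dist_add_of_mem_support (hp.takeUntil hmp) h)
  · have := hT.dist_add_of_mem_support (hp.dropUntil hmp) h
    exact Or.inr (by linarith)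

/-- The four-point condition. -/
theorem four_point (hT : IsTreeMetric G len) (v w x y : V) :
    dist v w + dist x y ≤ max (dist v x + dist w y) (dist v y + dist w x) := by
  obtain ⟨m, hm, hm1, hm2⟩ := hT.exists_median x y v
  obtain ⟨n, hn, hn1, hn2⟩ := hT.exists_median x y w
  have h1 : dist v w ≤ dist v m + dist m n + dist w n := by
    rw [dist_comm w n]
    exact dist_triangle4 v m n w
  rw [dist_comm x m] at hm
  rw [dist_comm x n] at hn
  -- The projections `m`, `n` of `v`, `w` to the geodesic from `x` to `y` occur in one of two
  -- orders, and each gives one side of the maximum: the two subsegments overlap exactly in the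
  -- segment between `m` and `n`.
  rcases hT.between_total (x := x) (y := y) (m := m) (n := n)
    (by rw [dist_comm x m]; exact hm) (by rw [dist_comm x n]; exact hn) with h | h
  · refine le_trans ?_ (le_max_left _ _)
    rw [dist_comm x n, dist_comm x m, dist_comm n m] at h
    linarith
  · refine le_trans ?_ (le_max_right _ _)
    rw [dist_comm x n, dist_comm x m] at h
    linarith

theorem eq_or_eq_of_adj (hT : IsTreeMetric G len) {x y m : V} (h : G.Adj x y)
    (hm : dist x m + dist m y = dist x y) : m = x ∨ m = y := by
  have hp : (SimpleGraph.Walk.cons h SimpleGraph.Walk.nil).IsPath := by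
    simp [SimpleGraph.Walk.cons_isPath_iff, h.ne]
  simpa using (hT.mem_support_iff hp).2 hm

theorem adj_of_forall (hT : IsTreeMetric G len) {x y : V} (hne : x ≠ y)
    (h : ∀ m, dist x m + dist m y = dist x y → m = x ∨ m = y) : G.Adj x y := by
  obtain ⟨p, hp⟩ := hT.exists_isPath x y
  cases p with
  | nil => exact absurd rfl hne
  | @cons _ z _ hxz q =>
    have hz : z ∈ (SimpleGraph.Walk.cons hxz q).support := by simp
    rcases h z (hT.dist_add_of_mem_support hp hz) with rfl | rfl
    · exact absurd rfl hxz.ne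
    · exact hxz

/-- Points strictly inside a geodesic are strictly closer to any given point than the farther
endpoint. -/
theorem dist_lt_of_between (hT : IsTreeMetric G len) {v w z x : V} {D : ℝ}
    (hz : dist v z + dist z w = dist v w) (hv : z ≠ v) (hw : z ≠ w)
    (hvx : dist v x ≤ D) (hwx : dist w x ≤ D) : dist z x < D := by
  have h1 := dist_pos.2 hv
  have h2 := dist_pos.2 hw
  have h3 := hT.four_point z x v w
  -- The right side is at most `D + max (dist v z) (dist z w)`, and that maximum is strictly less
  -- than `dist v w`.
  rw [dist_comm z v, dist_comm x w, dist_comm x v, max_def] at h3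
  rw [dist_comm z v] at h1
  split_ifs at h3 <;> linarith

theorem le_of_between (hT : IsTreeMetric G len) [LinearOrder V] {r u w : V}
    (hr : ∀ u w : V, RootedTreeLE G r u w → u ≤ w)
    (h : dist r u + dist u w = dist r w) : u ≤ w := by
  obtain ⟨p, hp⟩ := hT.exists_isPath r w
  exact hr u w ⟨⟨p, hp⟩, (hT.mem_support_iff hp).2 h⟩

end IsTreeMetric

/-! ### Diameters of simplices -/

section Diameter

variable {V : Type*} [MetricSpace V]

theorem simplexDiam_mono : Monotone (simplexDiam : Finset V → ℝ) := fun _ _ h =>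
  Metric.diam_mono (Finset.coe_subset.2 h) (Finset.finite_toSet _).isBounded

theorem dist_le_simplexDiam {σ : Finset V} {x y : V} (hx : x ∈ σ) (hy : y ∈ σ) :
    dist x y ≤ simplexDiam σ :=
  Metric.dist_le_diam_of_mem (Finset.finite_toSet _).isBounded hx hy

theorem simplexDiam_le {σ : Finset V} {D : ℝ} (hD : 0 ≤ D)
    (h : ∀ x ∈ σ, ∀ y ∈ σ, dist x y ≤ D) : simplexDiam σ ≤ D :=
  Metric.diam_le_of_forall_dist_le hD h

theorem exists_dist_eq_simplexDiam {σ : Finset V} (h : σ.Nonempty) :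
    ∃ x ∈ σ, ∃ y ∈ σ, dist x y = simplexDiam σ := by
  obtain ⟨⟨x, y⟩, hp, hmax⟩ := Finset.exists_max_image (σ ×ˢ σ) (fun p => dist p.1 p.2)
    (h.product h)
  rw [Finset.mem_product] at hp
  refine ⟨x, hp.1, y, hp.2, le_antisymm (dist_le_simplexDiam hp.1 hp.2) ?_⟩
  exact simplexDiam_le dist_nonneg fun a ha b hb => hmax (a, b) (Finset.mk_mem_product ha hb)

theorem simplexDiam_pos {σ : Finset V} (h : 1 < σ.card) : 0 < simplexDiam σ := by
  obtain ⟨x, hx, y, hy, hne⟩ := Finset.one_lt_card.1 h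
  exact (dist_pos.2 hne).trans_le (dist_le_simplexDiam hx hy)

theorem simplexDiam_pair [DecidableEq V] (x y : V) : simplexDiam {x, y} = dist x y := by
  refine le_antisymm (simplexDiam_le dist_nonneg ?_) (dist_le_simplexDiam (by simp) (by simp))
  intro a ha b hb
  simp only [Finset.mem_insert, Finset.mem_singleton] at ha hb
  rcases ha with rfl | rfl <;> rcases hb with rfl | rfl <;> simp [dist_comm, dist_nonneg]

end Diameter

/-! ### Zero-persistence apparent pairs of a tree metric -/

/-- The simplices of a graph: its vertices and its edges. -/
def IsGraphSimplex {V : Type*} (G : SimpleGraph V) (σ : Finset V) : Prop :=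
  (∃ v, (σ : Set V) = {v}) ∨ ∃ x y, G.Adj x y ∧ (σ : Set V) = {x, y}

theorem isGraphSimplex_singleton {V : Type*} (G : SimpleGraph V) (v : V) :
    IsGraphSimplex G {v} := Or.inl ⟨v, by simp⟩

theorem isGraphSimplex_pair {V : Type*} [DecidableEq V] {G : SimpleGraph V} {x y : V}
    (h : G.Adj x y) : IsGraphSimplex G {x, y} := Or.inr ⟨x, y, h, by simp⟩

theorem isGraphSimplex_of_mem_subforest {V : Type*} {G : SimpleGraph V} {len : Sym2 V → ℝ} {t : ℝ}
    {σ : Finset V}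
    (h : σ ∈ subforest G len t) : IsGraphSimplex G σ :=
  h.imp id fun ⟨x, y, hxy, _, hσ⟩ => ⟨x, y, hxy, hσ⟩

namespace IsTreeMetric

variable {V : Type*} [MetricSpace V] {G : SimpleGraph V} {len : Sym2 V → ℝ}

/-- A point outside an edge projects to one of its endpoints, so its distance to the other endpoint
exceeds the length of the edge. -/
theorem not_isGraphSimplex_of_mem (hT : IsTreeMetric G len) {σ : Finset V} {z : V}
    (hD : 0 < simplexDiam σ) (hz : z ∉ σ) (h : ∀ x ∈ σ, dist z x ≤ simplexDiam σ) :
    ¬ IsGraphSimplex G σ := by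
  classical
  rintro (⟨v, hv⟩ | ⟨x, y, hxy, hσ⟩)
  · rw [simplexDiam, hv, Metric.diam_singleton] at hD
    exact lt_irrefl _ hD
  · have hσ' : σ = {x, y} := by exact_mod_cast hσ
    subst hσ'
    rw [simplexDiam_pair] at h
    simp only [Finset.mem_insert, Finset.mem_singleton, not_or] at hz
    have hx := h x (by simp)
    have hy := h y (by simp)
    have h1 := dist_pos.2 hz.1
    have h2 := dist_pos.2 hz.2
    obtain ⟨m, hm, hm1, hm2⟩ := hT.exists_median x y z
    rcases hT.eq_or_eq_of_adj hxy hm with rfl | rfl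
    · linarith
    · rw [dist_comm m x] at hm1
      linarith

theorem subforest_le (hT : IsTreeMetric G len) {t : ℝ} (ht : 0 ≤ t) :
    subforest G len t ≤ vietorisRips V t := by
  rintro σ hσ
  refine ⟨(subforest G len t).nonempty hσ, ?_⟩
  rcases hσ with ⟨v, h⟩ | ⟨x, y, hxy, hl, h⟩
  · rw [h, Metric.diam_singleton]
    exact ht
  · rwa [h, Metric.diam_pair, hT.dist_of_adj hxy]

theorem mem_subforest_iff (hT : IsTreeMetric G len) {t : ℝ} {σ : Finset V}
    (hσ : σ ∈ vietorisRips V t) : σ ∈ subforest G len t ↔ IsGraphSimplex G σ := by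
  refine ⟨isGraphSimplex_of_mem_subforest, fun h => h.imp id ?_⟩
  rintro ⟨x, y, hxy, h⟩
  refine ⟨x, y, hxy, ?_, h⟩
  have := hσ.2
  rwa [h, Metric.diam_pair, hT.dist_of_adj hxy] at this

variable [Fintype V] [LinearOrder V]

/-- Every simplex which is neither a vertex nor an edge of the tree belongs to an apparent pair
of simplices of the same diameter, neither of which is a vertex or an edge of the tree. -/
theorem exists_isApparentPair (hT : IsTreeMetric G len) (hord : IsTreeCompatible G)
    {ρ : Finset V} (hne : ρ.Nonempty) (hρ : ¬ IsGraphSimplex G ρ) :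
    ∃ σ τ, IsApparentPair ⊤ simplexDiam σ τ ∧ simplexDiam σ = simplexDiam ρ ∧
      simplexDiam τ = simplexDiam ρ ∧ ¬ IsGraphSimplex G σ ∧ ¬ IsGraphSimplex G τ ∧
      (ρ = σ ∨ ρ = τ) := by
  classical
  obtain ⟨r, hr⟩ := hord
  have hcard : 1 < ρ.card := by
    by_contra hc
    have : ρ.card = 1 := by have := hne.card_pos; omega
    obtain ⟨v, rfl⟩ := Finset.card_eq_one.1 this
    exact hρ (isGraphSimplex_singleton G v)
  set D := simplexDiam ρ with hD
  have hDpos : 0 < D := simplexDiam_pos hcard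
  obtain ⟨p, hp, q, hq, hpq⟩ := exists_dist_eq_simplexDiam hne
  rw [← hD] at hpq
  let B : Finset V := Finset.univ.filter fun v => ∀ x ∈ ρ, dist v x ≤ D
  have mem_B : ∀ {v}, v ∈ B ↔ ∀ x ∈ ρ, dist v x ≤ D := by simp [B]
  have ρB : ρ ⊆ B := fun v hv => mem_B.2 fun x hx => dist_le_simplexDiam hv hx
  -- Four-point inequality against the diametral pair: `dist v w + D ≤ 2 * D`.
  have B_dist : ∀ v ∈ B, ∀ w ∈ B, dist v w ≤ D := by
    intro v hv w hw
    have h1 := hT.four_point v w p q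
    have h2 : max (dist v p + dist w q) (dist v q + dist w p) ≤ D + D :=
      max_le (add_le_add (mem_B.1 hv p hp) (mem_B.1 hw q hq))
        (add_le_add (mem_B.1 hv q hq) (mem_B.1 hw p hp))
    linarith
  have B_conv : ∀ v ∈ B, ∀ w ∈ B, ∀ z, dist v z + dist z w = dist v w → z ∈ B := by
    intro v hv w hw z hz
    by_cases h1 : z = v
    · exact h1 ▸ hv
    by_cases h2 : z = w
    · exact h2 ▸ hw
    exact mem_B.2 fun x hx =>
      (hT.dist_lt_of_between hz h1 h2 (mem_B.1 hv x hx) (mem_B.1 hw x hx)).le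
  have B_inner : ∀ v ∈ B, ∀ w ∈ B, ∀ z, dist v z + dist z w = dist v w → z ≠ v → z ≠ w →
      ∀ x ∈ B, dist z x < D := fun v hv w hw z hz h1 h2 x hx =>
    hT.dist_lt_of_between hz h1 h2 (B_dist v hv x hx) (B_dist w hw x hx)
  have diam_of_pair : ∀ {σ : Finset V}, σ ⊆ B → ∀ {x y}, x ∈ σ → y ∈ σ → dist x y = D →
      simplexDiam σ = D := fun hσ _ _ hx hy hxy => le_antisymm
    (simplexDiam_le hDpos.le fun a ha b hb => B_dist a (hσ ha) b (hσ hb))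
    (hxy ▸ dist_le_simplexDiam hx hy)
  -- Competing cofacets of the same diameter only add points of `B`, so minimality within `B`
  -- suffices below.
  have mem_B_of_insert : ∀ {σ : Finset V} {w}, σ ⊆ B → simplexDiam σ = D →
      simplexDiam (insert w σ) = D → w ∈ B := by
    intro σ w hσ h1 h2
    have hσne : σ.Nonempty := by
      rw [Finset.nonempty_iff_ne_empty]
      rintro rfl
      simp [simplexDiam] at h1
      exact hDpos.ne h1
    obtain ⟨x, hx, y, hy, hxy⟩ := exists_dist_eq_simplexDiam hσne
    have hw : ∀ z ∈ σ, dist w z ≤ D := fun z hz =>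
      h2 ▸ dist_le_simplexDiam (Finset.mem_insert_self _ _) (Finset.mem_insert_of_mem hz)
    refine mem_B.2 fun z hz => ?_
    have h3 := hT.four_point w z x y
    have h4 : max (dist w x + dist z y) (dist w y + dist z x) ≤ D + D :=
      max_le (add_le_add (hw x hx) (B_dist z (ρB hz) y (hσ hy)))
        (add_le_add (hw y hy) (B_dist z (ρB hz) x (hσ hx)))
    linarith
  -- The candidate pair is `ρ` without `v` and `ρ` with `v`; one of the two is `ρ` itself, whether
  -- or not `v` belongs to it.
  have toggle : ∀ v ∈ B, simplexDiam (ρ.erase v) = D →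
      (∀ w ∈ B, w ∉ ρ.erase v → v ≤ w) →
      (∀ w ∈ ρ.erase v, simplexDiam ((insert v ρ).erase w) = D → v ≤ w) →
      ∃ σ τ, IsApparentPair ⊤ simplexDiam σ τ ∧ simplexDiam σ = D ∧
        simplexDiam τ = D ∧ ¬ IsGraphSimplex G σ ∧ ¬ IsGraphSimplex G τ ∧
        (ρ = σ ∨ ρ = τ) := by
    intro v hv hdiam h1 h2
    have hτ : insert v (ρ.erase v) = insert v ρ := by
      ext x
      by_cases hx : x = v <;> simp [hx]
    have hτB : insert v ρ ⊆ B := Finset.insert_subset hv ρB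
    have hτD : simplexDiam (insert v ρ) = D :=
      diam_of_pair hτB (Finset.mem_insert_of_mem hp) (Finset.mem_insert_of_mem hq) hpq
    have hσB : ρ.erase v ⊆ B := (Finset.erase_subset _ _).trans ρB
    have hσρ : ρ = ρ.erase v ∨ ρ = insert v ρ := by
      by_cases h : v ∈ ρ
      · exact Or.inr (Finset.insert_eq_of_mem h).symm
      · exact Or.inl (Finset.erase_eq_of_notMem h).symm
    have hσG : ¬ IsGraphSimplex G (ρ.erase v) :=
      hT.not_isGraphSimplex_of_mem (z := v) (hdiam ▸ hDpos) (by simp)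
        fun x hx => hdiam ▸ B_dist v hv x (hσB hx)
    have hσne : (ρ.erase v).Nonempty := by
      rw [← Finset.card_pos]
      have := Finset.pred_card_le_card_erase (s := ρ) (a := v)
      omega
    have hp := isApparentPair_insert simplexDiam_mono hσne (Finset.notMem_erase v ρ)
      (by rw [hτ, hτD, hdiam])
      (fun w hw hwd => h1 w (mem_B_of_insert hσB hdiam (hwd.trans hdiam)) hw)
      (fun w hw hwd => h2 w hw (by rwa [hτ, hdiam] at hwd))
    rw [hτ] at hp
    refine ⟨_, _, hp, hdiam, hτD, hσG, ?_, hσρ⟩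
    rintro (⟨x, hx⟩ | ⟨x, y, hxy, h⟩)
    · rw [simplexDiam, hx, Metric.diam_singleton] at hτD
      exact hDpos.ne hτD
    · have hτ' : insert v ρ = {x, y} := by exact_mod_cast h
      have c1 := Finset.card_le_two (a := x) (b := y)
      rw [← hτ'] at c1
      rcases hσρ with h' | h'
      · have : v ∉ ρ := Finset.erase_eq_self.1 h'.symm
        rw [Finset.card_insert_of_notMem this] at c1
        omega
      · exact hρ (h'.symm ▸ hτ' ▸ isGraphSimplex_pair hxy)
  obtain ⟨a, haB, hamin⟩ : ∃ a ∈ B, ∀ w ∈ B, a ≤ w :=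
    Finset.exists_min_image B id ⟨p, ρB hp⟩
  by_cases ha : simplexDiam (ρ.erase a) = D
  · exact toggle a haB ha (fun w hw _ => hamin w hw)
      fun w hw _ => hamin w (ρB (Finset.mem_of_mem_erase hw))
  have haρ : a ∈ ρ := by
    by_contra h
    exact ha (by rw [Finset.erase_eq_of_notMem h])
  -- Otherwise a diametral pair of `ρ` avoids `a` and survives its removal.
  have ha_outer : ∃ x ∈ B, dist a x = D := by
    by_contra hcon
    push Not at hcon
    have hpa : p ≠ a := by rintro rfl; exact hcon q (ρB hq) hpq
    have hqa : q ≠ a := by rintro rfl; exact hcon p (ρB hp) (by rw [dist_comm]; exact hpq)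
    exact ha (diam_of_pair ((Finset.erase_subset _ _).trans ρB)
      (Finset.mem_erase.2 ⟨hpa, hp⟩) (Finset.mem_erase.2 ⟨hqa, hq⟩) hpq)
  have hBa : (B.erase a).Nonempty := by
    obtain ⟨x, hx, hxa⟩ := Finset.exists_mem_ne hcard a
    exact ⟨x, Finset.mem_erase.2 ⟨hxa, ρB hx⟩⟩
  obtain ⟨b, hb, hbmin⟩ : ∃ b ∈ B.erase a, ∀ w ∈ B.erase a, b ≤ w :=
    Finset.exists_min_image (B.erase a) id hBa
  obtain ⟨hba, hbB⟩ := Finset.mem_erase.1 hb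
  -- the meet of two points of `B` in the rooted tree
  have meet : ∀ v ∈ B, ∀ w ∈ B, ∃ m ∈ B, m ≤ v ∧ m ≤ w ∧ dist v m + dist m w = dist v w ∧
      dist r m + dist m v = dist r v ∧ dist r m + dist m w = dist r w := by
    intro v hv w hw
    obtain ⟨m, h1, h2, h3⟩ := hT.exists_median v w r
    exact ⟨m, B_conv v hv w hw m h1, hT.le_of_between hr h2, hT.le_of_between hr h3, h1, h2, h3⟩
  have anc_a : dist r a + dist a b = dist r b := by
    obtain ⟨m, hm, h1, -, -, -, h2⟩ := meet a haB b hbB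
    rwa [le_antisymm h1 (hamin m hm)] at h2
  have anc_b : ∀ w ∈ B, w ≠ a → dist r b + dist b w = dist r w := by
    intro w hw hwa
    obtain ⟨m, hm, h1, h2, h3, h4, h5⟩ := meet b hbB w hw
    -- The meet of `b` and `w` is in `B` by convexity and is at most `b`, so it is `a` or `b`. If it
    -- were `a`, then `a` would lie strictly inside a geodesic of `B`, contradicting `ha_outer`.
    by_cases hma : m = a
    · subst hma
      obtain ⟨x, hx, hxD⟩ := ha_outer
      exact absurd hxD (B_inner b hbB w hw m h3 (Ne.symm hba) (Ne.symm hwa) x hx).ne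
    · rwa [le_antisymm h1 (hbmin m (Finset.mem_erase.2 ⟨hma, hm⟩))] at h5
  have b_between : ∀ w ∈ B, w ≠ a → dist a b + dist b w = dist a w := by
    intro w hw hwa
    have h1 := anc_b w hw hwa
    have h2 := dist_triangle r a w
    have h3 := dist_triangle a b w
    linarith
  -- If `B = {a, b}`, convexity makes `a` and `b` adjacent and `ρ` is an edge.
  have hBab : ∃ w ∈ B, w ≠ a ∧ w ≠ b := by
    by_contra hcon
    push Not at hcon
    have hadj : G.Adj a b := hT.adj_of_forall (Ne.symm hba) fun m hm => by
      by_cases h : m = a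
      · exact Or.inl h
      · exact Or.inr (hcon m (B_conv a haB b hbB m hm) h)
    have hρsub : ρ ⊆ {a, b} := by
      intro x hx
      by_cases h : x = a
      · simp [h]
      · simp [hcon x (ρB hx) h]
    have hρe : ρ = {a, b} := Finset.eq_of_subset_of_card_le hρsub
      (Finset.card_le_two.trans hcard)
    exact hρ (hρe ▸ isGraphSimplex_pair hadj)
  obtain ⟨w, hwB, hwa, hwb⟩ := hBab
  have hb_inner : ∀ x ∈ B, dist b x < D :=
    B_inner a haB w hwB b (b_between w hwB hwa) hba (Ne.symm hwb)
  have hpb : p ≠ b := by rintro rfl; exact (hb_inner q (ρB hq)).ne hpq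
  have hqb : q ≠ b := by
    rintro rfl; exact (hb_inner p (ρB hp)).ne (by rw [dist_comm]; exact hpq)
  refine toggle b hbB ?_ ?_ ?_
  · exact diam_of_pair ((Finset.erase_subset _ _).trans ρB)
      (Finset.mem_erase.2 ⟨hpb, hp⟩) (Finset.mem_erase.2 ⟨hqb, hq⟩) hpq
  · intro w hw hw'
    refine hbmin w (Finset.mem_erase.2 ⟨?_, hw⟩)
    rintro rfl
    exact hw' (Finset.mem_erase.2 ⟨Ne.symm hba, haρ⟩)
  · intro w hw hwd
    refine hbmin w (Finset.mem_erase.2 ⟨?_, ρB (Finset.mem_of_mem_erase hw)⟩)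
    -- It remains to exclude `w = a`. A diametral pair left after removing `a` avoids the inner
    -- point `b`, so it already lies in `ρ.erase a`, contradicting `ha`.
    rintro rfl
    have hne' : ((insert b ρ).erase w).Nonempty :=
      ⟨b, Finset.mem_erase.2 ⟨hba, Finset.mem_insert_self _ _⟩⟩
    obtain ⟨x, hx, y, hy, hxy⟩ := exists_dist_eq_simplexDiam hne'
    rw [hwd] at hxy
    have hsub : insert b ρ ⊆ B := Finset.insert_subset hbB ρB
    have hxB := hsub (Finset.mem_of_mem_erase hx)
    have hyB := hsub (Finset.mem_of_mem_erase hy)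
    have hxb : x ≠ b := by rintro rfl; exact (hb_inner y hyB).ne hxy
    have hyb : y ≠ b := by
      rintro rfl; exact (hb_inner x hxB).ne (by rw [dist_comm]; exact hxy)
    simp only [Finset.mem_erase, Finset.mem_insert, hxb, hyb, false_or] at hx hy
    exact ha (diam_of_pair ((Finset.erase_subset _ _).trans ρB)
      (Finset.mem_erase.2 hx) (Finset.mem_erase.2 hy) hxy)

theorem inducesCollapse_subforest (hT : IsTreeMetric G len) (hord : IsTreeCompatible G)
    {t : ℝ} (ht : 0 ≤ t) :
    InducesCollapse (apparentPairsGradient V) (vietorisRips V t) (subforest G len t) := by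
  refine inducesCollapse_apparentPairs simplexDiam_mono le_top (hT.subforest_le ht) ?_
  rintro ρ ⟨hρ, hρ'⟩
  obtain ⟨σ, τ, hp, hσ, hτ, hσG, hτG, h⟩ := hT.exists_isApparentPair hord hρ.1
    fun h => hρ' ((hT.mem_subforest_iff hρ).2 h)
  exact ⟨σ, ⟨⟨hp.lower_mem, hσ.trans_le hρ.2⟩, fun h => hσG (isGraphSimplex_of_mem_subforest h)⟩,
    τ, ⟨⟨hp.upper_mem, hτ.trans_le hρ.2⟩, fun h => hτG (isGraphSimplex_of_mem_subforest h)⟩, hp, h⟩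

/-- The diameter of a tree edge is its length, so no vertex or edge of the tree has diameter in `(t,
u]`. Every simplex to be removed is therefore paired at its own diameter. -/
theorem inducesCollapse_vietorisRips (hT : IsTreeMetric G len) (hord : IsTreeCompatible G)
    {t u : ℝ} (ht : 0 ≤ t) (htu : t ≤ u) (he : ∀ e ∈ G.edgeSet, len e ∉ Set.Ioc t u) :
    InducesCollapse (apparentPairsGradient V) (vietorisRips V u) (vietorisRips V t) := by
  refine inducesCollapse_apparentPairs simplexDiam_mono le_top (vietorisRips_mono V htu) ?_
  rintro ρ ⟨hρ, hρ'⟩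
  have hlt : t < simplexDiam ρ := lt_of_not_ge fun h => hρ' ⟨hρ.1, h⟩
  obtain ⟨σ, τ, hp, hσ, hτ, -, -, h⟩ := hT.exists_isApparentPair hord hρ.1 <| by
    rintro (⟨v, hv⟩ | ⟨x, y, hxy, h⟩)
    · rw [simplexDiam, hv, Metric.diam_singleton] at hlt
      exact ht.not_gt hlt
    · have h1 := hρ.2
      rw [simplexDiam] at hlt
      rw [h, Metric.diam_pair, hT.dist_of_adj hxy] at hlt h1
      exact he _ ((SimpleGraph.mem_edgeSet G).2 hxy) ⟨hlt, h1⟩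
  exact ⟨σ, ⟨⟨hp.lower_mem, hσ.trans_le hρ.2⟩, fun h => (hσ ▸ hlt).not_ge h.2⟩,
    τ, ⟨⟨hp.upper_mem, hτ.trans_le hρ.2⟩, fun h => (hτ ▸ hlt).not_ge h.2⟩, hp, h⟩

end IsTreeMetric

/-! ### Chains on all finite sets of vertices -/

/-- The chains of `K` on simplices with `n` vertices. -/
def chainsOn (R : Type*) [CommRing R] {V : Type*} (K : PreAbstractSimplicialComplex V) (n : ℕ) :
    Submodule R (Finset V →₀ R) :=
  Finsupp.supported R R {σ | σ ∈ K ∧ σ.card = n}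

theorem mem_chainsOn {R : Type*} [CommRing R] {V : Type*} {K : PreAbstractSimplicialComplex V}
    {n : ℕ} {z : Finset V →₀ R} :
    z ∈ chainsOn R K n ↔ ∀ σ, z σ ≠ 0 → σ ∈ K ∧ σ.card = n := by
  rw [chainsOn, Finsupp.mem_supported]
  exact ⟨fun h σ hσ => h (Finsupp.mem_support_iff.2 hσ),
    fun h σ hσ => h σ (Finsupp.mem_support_iff.1 hσ)⟩

theorem chainsOn_mono {R : Type*} [CommRing R] {V : Type*} {K L : PreAbstractSimplicialComplex V}
    (h : L ≤ K) (n : ℕ) :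
    chainsOn R L n ≤ chainsOn R K n :=
  Finsupp.supported_mono fun _ hσ => ⟨h hσ.1, hσ.2⟩

section Chains

variable (R : Type*) [CommRing R] {V : Type*} [LinearOrder V]

/-- The boundary map on formal combinations of finite sets of vertices. -/
noncomputable def chainBoundary : (Finset V →₀ R) →ₗ[R] (Finset V →₀ R) :=
  Finsupp.linearCombination R fun σ => ∑ v ∈ σ, Finsupp.single (σ.erase v) (faceSign R σ v)

theorem chainBoundary_single (σ : Finset V) (a : R) :
    chainBoundary R (Finsupp.single σ a) =
      a • ∑ v ∈ σ, Finsupp.single (σ.erase v) (faceSign R σ v) := by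
  simp [chainBoundary]

theorem faceSign_mul_self (σ : Finset V) (v : V) : faceSign R σ v * faceSign R σ v = 1 := by
  rw [faceSign, ← mul_pow]
  simp

theorem chainBoundary_chainBoundary (z : Finset V →₀ R) :
    chainBoundary R (chainBoundary R z) = 0 := by
  suffices h : chainBoundary R ∘ₗ chainBoundary R = (0 : (Finset V →₀ R) →ₗ[R] _) from
    LinearMap.congr_fun h z
  refine Finsupp.lhom_ext fun σ a => ?_
  rw [LinearMap.comp_apply, chainBoundary_single, map_smul, map_sum, LinearMap.zero_apply]
  simp only [chainBoundary_single, Finset.smul_sum, Finsupp.smul_single, smul_eq_mul]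
  rw [Finset.sum_sigma']
  refine Finset.sum_involution (fun p _ => ⟨p.2, p.1⟩) ?_ ?_ ?_ ?_
  · rintro ⟨v, w⟩ h
    simp only [Finset.mem_sigma, Finset.mem_erase] at h
    obtain ⟨hv, hwv, hw⟩ := h
    have hs : faceSign R σ v * faceSign R (σ.erase v) w +
        faceSign R σ w * faceSign R (σ.erase w) v = 0 := by
      rcases lt_or_gt_of_ne hwv with h | h
      · rw [add_comm]; exact faceSign_cancel R σ hw h
      · exact faceSign_cancel R σ hv h
    dsimp only
    rw [Finset.erase_right_comm, ← Finsupp.single_add, ← mul_add, hs, mul_zero,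
      Finsupp.single_zero]
  · rintro ⟨v, w⟩ h - he
    simp only [Finset.mem_sigma, Finset.mem_erase] at h
    exact h.2.1 (congrArg Sigma.fst he)
  · rintro ⟨v, w⟩ h
    simp only [Finset.mem_sigma, Finset.mem_erase] at h ⊢
    exact ⟨h.2.2, Ne.symm h.2.1, h.1⟩
  · intros; rfl

theorem chainBoundary_single_apply_erase {τ : Finset V} {v : V} (hv : v ∈ τ) (a : R) :
    chainBoundary R (Finsupp.single τ a) (τ.erase v) = a * faceSign R τ v := by
  rw [chainBoundary_single, Finsupp.smul_apply, Finsupp.finsetSum_apply,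
    Finset.sum_eq_single v, Finsupp.single_eq_same, smul_eq_mul]
  · intro w hw hwv
    refine Finsupp.single_eq_of_ne fun h => hwv ?_
    exact (Finset.erase_injOn τ hv hw h).symm
  · exact fun h => absurd hv h

theorem chainBoundary_single_apply_of_not_isFacet {σ τ : Finset V} (h : ¬ IsFacet σ τ) (a : R) :
    chainBoundary R (Finsupp.single τ a) σ = 0 := by
  rw [chainBoundary_single, Finsupp.smul_apply, Finsupp.finsetSum_apply,
    Finset.sum_eq_zero, smul_zero]
  intro w hw
  refine Finsupp.single_eq_of_ne fun he => h ?_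
  rw [he]
  exact ⟨Finset.erase_subset _ _, (Finset.card_erase_add_one hw).symm⟩

/-- If `τ` is the only cofacet of `σ` in the support of `z`, then the coefficient of `σ` in the
boundary of `z` is, up to sign, the coefficient of `τ` in `z`. -/
theorem eq_zero_of_unique_cofacet {z : Finset V →₀ R} (hz : chainBoundary R z = 0)
    {σ τ : Finset V} (hστ : IsFacet σ τ) (h : ∀ ρ, z ρ ≠ 0 → IsFacet σ ρ → ρ = τ) : z τ = 0 := by
  obtain ⟨v, hv, rfl⟩ := hστ.exists_insert
  have h1 : chainBoundary R z σ = z (insert v σ) * faceSign R (insert v σ) v := by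
    conv_lhs => rw [← Finsupp.sum_single z, Finsupp.sum, map_sum, Finsupp.finsetSum_apply]
    have h2 := chainBoundary_single_apply_erase R (Finset.mem_insert_self v σ) (z (insert v σ))
    rw [Finset.erase_insert hv] at h2
    rw [Finset.sum_eq_single (insert v σ), h2]
    · intro ρ hρ hne
      refine chainBoundary_single_apply_of_not_isFacet R (fun hf => hne ?_) _
      exact h ρ (Finsupp.mem_support_iff.1 hρ) hf
    · intro hn
      rw [Finsupp.notMem_support_iff.1 hn]
      simp
  rw [hz, Finsupp.zero_apply] at h1
  calc z (insert v σ) = z (insert v σ) * faceSign R (insert v σ) v *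
        faceSign R (insert v σ) v := by rw [mul_assoc, faceSign_mul_self, mul_one]
    _ = 0 := by rw [← h1, zero_mul]

variable {R}

/-- For `n = 0` this fails: `chainBoundary` sends a vertex to a multiple of the empty set, which is
not a simplex of `K`. -/
theorem chainBoundary_single_mem_chainsOn {K : PreAbstractSimplicialComplex V} {n : ℕ}
    {τ : Finset V} (hτ : τ ∈ K) (hc : τ.card = n + 1) (hn : 0 < n) (a : R) :
    chainBoundary R (Finsupp.single τ a) ∈ chainsOn R K n := by
  refine mem_chainsOn.2 fun σ hσ => ?_
  have hf : IsFacet σ τ := by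
    by_contra h
    exact hσ (chainBoundary_single_apply_of_not_isFacet R h a)
  have hcard : σ.card = n := by have := hf.2; omega
  exact ⟨K.mem_of_subset hτ hf.1 (Finset.card_pos.1 (by omega)), hcard⟩

variable (R)

/-- Every cycle of `K` on simplices with `n` vertices is a boundary. -/
def CyclesBound (K : PreAbstractSimplicialComplex V) (n : ℕ) : Prop :=
  ∀ z ∈ chainsOn R K n, chainBoundary R z = 0 → ∃ w ∈ chainsOn R K (n + 1), chainBoundary R w = z

variable {R}

/-- In the dimension of `σ`, a multiple of the boundary of `τ` is subtracted to cancel the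
coefficient at `σ`. In any other dimension a cycle already lies in `L`, because the coefficient at
`τ` vanishes: `σ` has no other cofacet. -/
theorem CyclesBound.of_isElementaryCollapse {K L : PreAbstractSimplicialComplex V}
    {σ τ : Finset V} (h : IsElementaryCollapse K L σ τ) {n : ℕ} (hn : 0 < n)
    (hL : CyclesBound R L n) : CyclesBound R K n := by
  intro z hz hdz
  have hLK : L ≤ K := by
    intro ρ hρ
    have hρ' : ρ ∈ K.faces \ {σ, τ} := h.faces_eq ▸ hρ
    exact hρ'.1
  have mem_L : ∀ ρ ∈ K, ρ ≠ σ → ρ ≠ τ → ρ ∈ L := by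
    intro ρ hρ h1 h2
    have : ρ ∈ L.faces := h.faces_eq ▸ (⟨hρ, by simp [h1, h2]⟩ : ρ ∈ K.faces \ {σ, τ})
    exact this
  by_cases hσ : σ.card = n
  · obtain ⟨v, hv, hτ⟩ := h.isFacet.exists_insert
    have hvτ : v ∈ τ := hτ ▸ Finset.mem_insert_self v σ
    have hσe : τ.erase v = σ := by rw [← hτ, Finset.erase_insert hv]
    have hτc : τ.card = n + 1 := by rw [h.isFacet.2, hσ]
    set y : Finset V →₀ R := Finsupp.single τ (z σ * faceSign R τ v) with hy
    have hyK : y ∈ chainsOn R K (n + 1) := Finsupp.single_mem_supported R _ ⟨h.upper_mem, hτc⟩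
    have hdy : chainBoundary R y ∈ chainsOn R K n :=
      chainBoundary_single_mem_chainsOn h.upper_mem hτc hn _
    have hdyσ : chainBoundary R y σ = z σ := by
      have := chainBoundary_single_apply_erase R hvτ (z σ * faceSign R τ v)
      rwa [hσe, mul_assoc, faceSign_mul_self, mul_one] at this
    have hz' : z - chainBoundary R y ∈ chainsOn R L n := by
      refine mem_chainsOn.2 fun ρ hρ => ?_
      obtain ⟨hρK, hρc⟩ := mem_chainsOn.1 (Submodule.sub_mem _ hz hdy) ρ hρ
      refine ⟨mem_L ρ hρK ?_ ?_, hρc⟩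
      · rintro rfl
        rw [Finsupp.sub_apply, hdyσ, sub_self] at hρ
        exact hρ rfl
      · rintro rfl
        omega
    obtain ⟨w, hw, hdw⟩ := hL _ hz' (by rw [map_sub, hdz, chainBoundary_chainBoundary, sub_zero])
    exact ⟨w + y, Submodule.add_mem _ (chainsOn_mono hLK _ hw) hyK, by rw [map_add, hdw]; abel⟩
  · have hzL : z ∈ chainsOn R L n := by
      refine mem_chainsOn.2 fun ρ hρ => ?_
      obtain ⟨hρK, hρc⟩ := mem_chainsOn.1 hz ρ hρ
      refine ⟨mem_L ρ hρK ?_ ?_, hρc⟩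
      · rintro rfl
        exact hσ hρc
      · rintro rfl
        refine hρ (eq_zero_of_unique_cofacet R hdz h.isFacet fun π hπ hf => ?_)
        exact h.unique_coface π (mem_chainsOn.1 hz π hπ).1 hf.ssubset
    obtain ⟨w, hw, hdw⟩ := hL z hzL hdz
    exact ⟨w, chainsOn_mono hLK _ hw, hdw⟩

theorem CyclesBound.of_collapsesAlong {W : Set (Finset V × Finset V)}
    {K L : PreAbstractSimplicialComplex V} (h : CollapsesAlong W K L) {n : ℕ} (hn : 0 < n)
    (hL : CyclesBound R L n) : CyclesBound R K n := by
  induction h using Relation.ReflTransGen.head_induction_on with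
  | refl => exact hL
  | head h _ ih =>
    obtain ⟨p, -, hp⟩ := h
    exact ih.of_isElementaryCollapse hp hn

end Chains

/-! ### Forests have no cycles -/

namespace IsTreeMetric

variable {V : Type*} [MetricSpace V] {G : SimpleGraph V} {len : Sym2 V → ℝ}

/-- A neighbour of `b` no farther from `r` than `b` lies on the geodesic from `r` to `b`. Two such
neighbours are ordered along it, and no vertex lies strictly inside an edge. -/
theorem parent_unique (hT : IsTreeMetric G len) {r a b c : V} (ha : G.Adj a b)
    (hc : G.Adj c b) (hra : dist r a ≤ dist r b) (hrc : dist r c ≤ dist r b) : a = c := by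
  have key : ∀ {x}, G.Adj x b → dist r x ≤ dist r b → dist r x + dist x b = dist r b := by
    intro x hx hrx
    obtain ⟨m, hm, h1, h2⟩ := hT.exists_median x b r
    rcases hT.eq_or_eq_of_adj hx hm with rfl | rfl
    · exact h2
    · have := dist_pos.2 hx.ne
      rw [dist_comm m x] at h1
      linarith
  have h1 := key ha hra
  have h2 := key hc hrc
  rcases hT.between_total h1 h2 with h | h
  · exact (hT.eq_or_eq_of_adj hc (m := a) (by linarith)).resolve_right ha.ne
  · exact ((hT.eq_or_eq_of_adj ha (m := c) (by linarith)).resolve_right hc.ne).symm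

/-- A cycle here is zero. Root the tree at a vertex `r` of the support: a vertex `b` of the support
farthest from `r` lies on only one edge of the support, so that edge has coefficient zero. -/
theorem cyclesBound_subforest (hT : IsTreeMetric G len) [LinearOrder V] (R : Type*) [CommRing R]
    (t : ℝ) {n : ℕ} (hn : 2 ≤ n) : CyclesBound R (subforest G len t) n := by
  intro z hz hdz
  rw [mem_chainsOn] at hz
  suffices h0 : z = 0 from ⟨0, Submodule.zero_mem _, by rw [map_zero, h0]⟩
  have edge : ∀ σ, z σ ≠ 0 → ∃ x y, G.Adj x y ∧ σ = {x, y} := by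
    intro σ hσ
    obtain ⟨h, hc⟩ := hz σ hσ
    rcases h with ⟨v, hv⟩ | ⟨x, y, hxy, -, h⟩
    · have : σ = {v} := by exact_mod_cast hv
      rw [this, Finset.card_singleton] at hc
      omega
    · exact ⟨x, y, hxy, by exact_mod_cast h⟩
  by_contra hne
  obtain ⟨σ₀, hσ₀⟩ := Finsupp.support_nonempty_iff.2 hne
  obtain ⟨r, y₀, -, hr⟩ := edge σ₀ (Finsupp.mem_support_iff.1 hσ₀)
  obtain ⟨b, hb, hmax⟩ := Finset.exists_max_image (z.support.biUnion id) (dist r)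
    ⟨r, Finset.mem_biUnion.2 ⟨σ₀, hσ₀, by simp [hr]⟩⟩
  simp only [Finset.mem_biUnion, id] at hb hmax
  have edge_at : ∀ σ, z σ ≠ 0 → b ∈ σ → ∃ a, G.Adj a b ∧ σ = {a, b} ∧ dist r a ≤ dist r b := by
    intro σ hσ hbσ
    obtain ⟨x, y, hxy, rfl⟩ := edge σ hσ
    have hx := hmax x ⟨_, Finsupp.mem_support_iff.2 hσ, by simp⟩
    have hy := hmax y ⟨_, Finsupp.mem_support_iff.2 hσ, by simp⟩
    simp only [Finset.mem_insert, Finset.mem_singleton] at hbσ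
    rcases hbσ with rfl | rfl
    · exact ⟨y, hxy.symm, Finset.pair_comm _ _, hy⟩
    · exact ⟨x, hxy, rfl, hx⟩
  obtain ⟨τ, hτ, hbτ⟩ := hb
  have hτ0 := Finsupp.mem_support_iff.1 hτ
  obtain ⟨a, hab, rfl, hra⟩ := edge_at τ hτ0 hbτ
  have hf : IsFacet {b} ({a, b} : Finset V) :=
    ⟨by simp, by rw [Finset.card_pair hab.ne, Finset.card_singleton]⟩
  refine hτ0 (eq_zero_of_unique_cofacet R hdz hf fun ρ hρ hfρ => ?_)
  obtain ⟨c, hcb, rfl, hrc⟩ := edge_at ρ hρ (hfρ.1 (Finset.mem_singleton_self b))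
  rw [hT.parent_unique hab hcb hra hrc]

theorem cyclesBound_vietorisRips (hT : IsTreeMetric G len) [Fintype V] [LinearOrder V]
    (hord : IsTreeCompatible G) (R : Type*) [CommRing R] (t : ℝ) {n : ℕ} (hn : 2 ≤ n) :
    CyclesBound R (vietorisRips V t) n := by
  rcases le_or_gt 0 t with ht | ht
  · exact (hT.cyclesBound_subforest R t hn).of_collapsesAlong
      (hT.inducesCollapse_subforest hord ht).collapses (by omega)
  -- For `t < 0` the complex is empty, as diameters are nonnegative.
  · intro z hz _
    refine ⟨0, Submodule.zero_mem _, ?_⟩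
    rw [map_zero]
    ext σ
    by_contra hσ
    exact (ht.trans_le Metric.diam_nonneg).not_ge ((mem_chainsOn.1 hz σ (Ne.symm hσ)).1).2

end IsTreeMetric

/-! ### Vanishing of simplicial homology -/

section Homology

variable (R : Type*) [CommRing R] {V : Type*}

/-- The inclusion of the chain module of `K` into the formal combinations of finite sets. -/
noncomputable def chainInclusion (K : PreAbstractSimplicialComplex V) (n : ℕ) :
    (SimplexOfDim K n →₀ R) →ₗ[R] (Finset V →₀ R) :=
  Finsupp.lmapDomain R R Subtype.val

theorem chainInclusion_injective (K : PreAbstractSimplicialComplex V) (n : ℕ) :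
    Function.Injective (chainInclusion R K n) :=
  Finsupp.mapDomain_injective Subtype.val_injective

theorem range_chainInclusion (K : PreAbstractSimplicialComplex V) (n : ℕ) :
    LinearMap.range (chainInclusion R K n) = chainsOn R K (n + 1) := by
  rw [chainInclusion, Finsupp.range_lmapDomain, chainsOn, Finsupp.supported_eq_span_single,
    Set.image_eq_range]
  rfl

variable [LinearOrder V]

theorem chainBoundary_chainInclusion (K : PreAbstractSimplicialComplex V) (n : ℕ)
    (z : SimplexOfDim K (n + 1) →₀ R) :
    chainBoundary R (chainInclusion R K (n + 1) z) =
      chainInclusion R K n (simplicialBoundary R K n z) := by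
  suffices h : chainBoundary R ∘ₗ chainInclusion R K (n + 1) =
      chainInclusion R K n ∘ₗ simplicialBoundary R K n from LinearMap.congr_fun h z
  refine Finsupp.lhom_ext fun σ a => ?_
  simp only [LinearMap.comp_apply, chainInclusion, Finsupp.lmapDomain_apply,
    Finsupp.mapDomain_single, simplicialBoundary_single, chainBoundary_single,
    Finsupp.mapDomain_smul, Finsupp.mapDomain_finsetSum]
  exact congrArg (a • ·) (Finset.sum_coe_sort σ.1
    (fun v => Finsupp.single (σ.1.erase v) (faceSign R σ.1 v))).symm

theorem CyclesBound.exists_simplicialBoundary_eq {K : PreAbstractSimplicialComplex V} {n : ℕ}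
    (h : CyclesBound R K (n + 2)) (z : SimplexOfDim K (n + 1) →₀ R)
    (hz : simplicialBoundary R K n z = 0) : ∃ y, simplicialBoundary R K (n + 1) y = z := by
  obtain ⟨w, hw, hdw⟩ := h (chainInclusion R K (n + 1) z)
    (range_chainInclusion R K (n + 1) ▸ LinearMap.mem_range_self _ _)
    (by rw [chainBoundary_chainInclusion, hz, map_zero])
  rw [← range_chainInclusion] at hw
  obtain ⟨y, rfl⟩ := hw
  refine ⟨y, chainInclusion_injective R K (n + 1) ?_⟩
  rw [← hdw, chainBoundary_chainInclusion]

/-- `CyclesBound` counts vertices, so degree `n + 1` corresponds to `n + 2`. -/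
theorem isZero_homology_of_cyclesBound (K : PreAbstractSimplicialComplex V) (n : ℕ)
    (h : CyclesBound R K (n + 2)) :
    Limits.IsZero ((simplicialChainComplex R K).homology (n + 1)) := by
  rw [← HomologicalComplex.exactAt_iff_isZero_homology,
    HomologicalComplex.exactAt_iff' _ (n + 2) (n + 1) n (by simp) (by simp),
    ShortComplex.moduleCat_exact_iff]
  have hd : ∀ m, (simplicialChainComplex R K).d (m + 1) m =
      ModuleCat.ofHom (simplicialBoundary R K m) := fun m => by
    dsimp only [simplicialChainComplex]
    rw [ChainComplex.of_d]
  intro z hz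
  obtain ⟨y, hy⟩ := h.exists_simplicialBoundary_eq R z
    ((congrArg (fun φ => φ.hom z) (hd n)).symm.trans hz)
  exact ⟨y, (congrArg (fun φ => φ.hom y) (hd (n + 1))).trans hy⟩

end Homology

theorem mainTheorem2 {V : Type*} [Fintype V] [MetricSpace V] [LinearOrder V]
    (G : SimpleGraph V) (len : Sym2 V → ℝ)
    (hT : IsTreeMetric G len) (hord : IsTreeCompatible G) :
    IsDiscreteGradient ⊤ (apparentPairsGradient V) ∧
    (∀ t u : ℝ, 0 < t → t < u → (∀ e ∈ G.edgeSet, len e ∉ Set.Ioc t u) →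
      InducesCollapse (apparentPairsGradient V) (vietorisRips V u) (vietorisRips V t) ∧
      InducesCollapse (apparentPairsGradient V) (vietorisRips V t) (subforest G len t)) ∧
    (∀ (R : Type*) [CommRing R] (i : ℕ), 0 < i →
      Limits.IsZero (vietorisRipsPersistentHomology R V i)) := by
  refine ⟨isDiscreteGradient_apparentPairs ⊤ simplexDiam_mono, fun t u ht htu he =>
    ⟨hT.inducesCollapse_vietorisRips hord ht.le htu.le he,
      hT.inducesCollapse_subforest hord ht.le⟩, fun R _ i hi => ?_⟩
  obtain ⟨n, rfl⟩ : ∃ n, i = n + 1 := ⟨i - 1, by omega⟩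
  rw [Functor.isZero_iff]
  exact fun t => isZero_homology_of_cyclesBound R (vietorisRips V t) n
    (hT.cyclesBound_vietorisRips hord R t (by omega))
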